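/- Identify $\mathbb R^2\cong\mathbb C$. Let $\Omega\subset\mathbb R^2$ be open and let $m:\Omega\to\mathbb R^2$ satisfy $|m|=1$ a.e. in $\Omega$ and $\operatorname{div} m=0$ in $\mathcal D'(\Omega)$. For $x\in\Omega$ and $0<\varepsilon<\operatorname{dist}(x,\partial\Omega)$ put $$\mathcal P_m^{\varepsilon}(x)=\varepsilon^{-3}\int_{B_\varepsilon(0)}|m(x+z)-m(x)|^3\,dz .$$ Let $1\le p<\infty$ and suppose that for some sequence $\varepsilon_k\to0$, $\varepsilon_k>0$, there is $\mathcal P_m\in L^p_{\rm loc}(\Omega)$ with $\mathcal P_m^{\varepsilon_k}\rightharpoonup\mathcal P_m$ in $L^p_{\rm loc}(\Omega)$ (that is, weakly in $L^p(U)$ for every open $U\subset\subset\Omega$). Let $\theta:\Omega\to[0,2\pi)$ satisfy $m=e^{i\theta}$ a.e. in $\Omega$, and let $$\Sigma_1(z)=\Bigl(z_2\bigl(1-z_1^2-\tfrac{z_2^2}{3}\bigr),\,z_1\bigl(1-z_2^2-\tfrac{z_1^2}{3}\bigr)\Bigr),\qquad \Sigma_2(z)=\Bigl(-z_1\bigl(1-\tfrac{2z_1^2}{3}\bigr),\,z_2\bigl(1-\tfrac{2z_2^2}{3}\bigr)\Bigr).$$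 For $\psi\in C^4(\mathbb S^1)$ with Fourier coefficients $c_k=\frac1{2\pi}\int_0^{2\pi}\psi(e^{it})e^{-ikt}\,dt$, let $E\psi(re^{it})=\sum_{k\in\mathbb Z}c_k r^{|k|}e^{ikt}$, $0\le r\le1$, be its harmonic extension to the closed unit disc $\overline B_1$, let $$\mathcal A_1\psi(e^{it})=\sum_{k\in\mathbb Z}\tfrac{ik}{2}(k^2-1)\,c_k\,e^{ikt},$$ and, for real-valued $\psi$, let $\Phi^{E\psi}(z)=E\psi(z)\,z+\bigl(iz\cdot\nabla E\psi(z)\bigr)\,iz$ for $z\in\overline B_1$. Then: 1. The distributions $\operatorname{div}\Sigma_1(m)$ and $\operatorname{div}\Sigma_2(m)$ belong to $L^p_{\rm loc}(\Omega)$, and, writing $\operatorname{div}\Sigma(m)=(\operatorname{div}\Sigma_1(m),\operatorname{div}\Sigma_2(m))$, one has $ie^{2i\theta}\cdot\operatorname{div}\Sigma(m)=0$ a.e. in $\Omega$. 2. For every real-valued $\psi\in C^4(\mathbb S^1)$, $\operatorname{div}\Phi^{E\psi}(m)\in L^p_{\rm loc}(\Omega)$ and $$\operatorname{div}\Phi^{E\psi}(m)=\mathcal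 A_1\psi(m)\;e^{2i\theta}\cdot\operatorname{div}\Sigma(m)\quad\text{a.e. in }\Omega .$$ 3. For every (complex-valued) $\psi\in C^4(\mathbb S^1)$, $\mathcal A_1\psi=-\tfrac12(\psi'''+\psi')$, where $'$ denotes the derivative with respect to the angle $t$. -/

import Mathlib

open MeasureTheory Filter Topology Set
open scoped ENNReal Real ComplexConjugate

noncomputable section

/- Throughout, the plane `ℝ²` is identified with `ℂ`, both as domain and as target:
`z = z₁ + i z₂ ↔ (z₁, z₂)`. The measure `volume` on `ℂ` is two-dimensional Lebesgue measure,
`‖·‖` is the Euclidean norm and `inner ℝ z w = z₁ w₁ + z₂ w₂`. -/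
namespace Eikonal

/-! ### Local Lebesgue spaces, weak convergence and distributional divergence -/

/-- `f ∈ L^p_loc(Ω)`. -/
def MemLpLoc (Ω : Set ℂ) (p : ℝ≥0∞) (f : ℂ → ℝ) : Prop :=
  ∀ K : Set ℂ, IsCompact K → K ⊆ Ω → MemLp f p (volume.restrict K)

/-- Weak convergence `u_k ⇀ v` in `L^p_loc(Ω)`, for `1 ≤ p < ∞`: for every open `U ⊂⊂ Ω`, the
functions `u_k` belong to `L^p(U)` for large `k`, `v` belongs to `L^p(U)`, and the pairings with
every element of the dual space `L^{p'}(U)` converge. -/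
def TendstoWeaklyLpLoc (Ω : Set ℂ) (p : ℝ≥0∞) (u : ℕ → ℂ → ℝ) (v : ℂ → ℝ) : Prop :=
  ∀ U : Set ℂ, IsOpen U → IsCompact (closure U) → closure U ⊆ Ω →
    (∀ᶠ k in atTop, MemLp (u k) p (volume.restrict U)) ∧
    MemLp v p (volume.restrict U) ∧
    ∀ h : ℂ → ℝ, MemLp h (ENNReal.conjExponent p) (volume.restrict U) →
      Tendsto (fun k => ∫ x in U, u k x * h x) atTop (𝓝 (∫ x in U, v x * h x))

/-- `div F = g` in `𝒟'(Ω)`, for locally integrable `F : Ω → ℝ²` and `g : Ω → ℝ`: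
`∫_Ω F · ∇ζ = - ∫_Ω g ζ` for all `ζ ∈ C_c^∞(Ω)`. Note that `F · ∇ζ` is the derivative of `ζ` in
the direction `F`. -/
def HasWeakDiv (Ω : Set ℂ) (F : ℂ → ℂ) (g : ℂ → ℝ) : Prop :=
  LocallyIntegrableOn F Ω ∧ LocallyIntegrableOn g Ω ∧
    ∀ ζ : ℂ → ℝ, ContDiff ℝ (⊤ : ℕ∞) ζ → HasCompactSupport ζ → tsupport ζ ⊆ Ω →
      ∫ x in Ω, fderiv ℝ ζ x (F x) = - ∫ x in Ω, g x * ζ x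

/-- The distributional divergence of `F` on `Ω` is (represented by) the function
`g ∈ L^p_loc(Ω)`. -/
def HasLpLocDiv (Ω : Set ℂ) (p : ℝ≥0∞) (F : ℂ → ℂ) (g : ℂ → ℝ) : Prop :=
  MemLpLoc Ω p g ∧ HasWeakDiv Ω F g

/-! ### The Eikonal equation, the function `𝒫_m^ε` and the Jin–Kohn entropies -/

/-- `|m| = 1` a.e. in `Ω` and `div m = 0` in `𝒟'(Ω)` (in particular `m` is measurable on `Ω`). -/
def IsEikonalSolution (Ω : Set ℂ) (m : ℂ → ℂ) : Prop :=
  (∀ᵐ x ∂(volume.restrict Ω), ‖m x‖ = 1) ∧ HasWeakDiv Ω m (fun _ => 0)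

/-- `𝒫_m^ε(x) = ε⁻³ ∫_{B_ε(0)} |m(x+z) - m(x)|³ dz`; used for `0 < ε < dist(x, ∂Ω)`. -/
def cubicIncrement (m : ℂ → ℂ) (ε : ℝ) (x : ℂ) : ℝ :=
  (ε ^ 3)⁻¹ * ∫ z in Metric.ball (0 : ℂ) ε, ‖m (x + z) - m x‖ ^ 3

/-- The Jin–Kohn entropy `Σ₁`. -/
def jinKohn₁ (z : ℂ) : ℂ :=
  ⟨z.im * (1 - z.re ^ 2 - z.im ^ 2 / 3), z.re * (1 - z.im ^ 2 - z.re ^ 2 / 3)⟩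

/-- The Jin–Kohn entropy `Σ₂`. -/
def jinKohn₂ (z : ℂ) : ℂ :=
  ⟨-z.re * (1 - 2 * z.re ^ 2 / 3), z.im * (1 - 2 * z.im ^ 2 / 3)⟩

/-! ### Functions on the circle, harmonic extension and harmonic entropies -/

/-- `ψ ∈ C⁴(𝕊¹)`: `t ↦ ψ(e^{it})` is four times continuously differentiable. -/
def IsC4 {F : Type*} [NormedAddCommGroup F] [NormedSpace ℝ F] (ψ : Circle → F) : Prop :=
  ContDiff ℝ 4 (fun t : ℝ => ψ (Circle.exp t))

/-- The Fourier coefficient `c_k(ψ) = (1/2π) ∫₀^{2π} ψ(e^{it}) e^{-ikt} dt`. -/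
def circleCoeff (ψ : Circle → ℂ) (k : ℤ) : ℂ :=
  haveI : Fact (0 < 2 * π) := ⟨Real.two_pi_pos⟩
  fourierCoeff (fun t : AddCircle (2 * π) => ψ t.toCircle) k

/-- The function `r e^{iθ} ↦ r^{|k|} e^{ikθ}`; see `discMode_polar`. -/
def discMode (k : ℤ) (z : ℂ) : ℂ :=
  if 0 ≤ k then z ^ k.natAbs else conj z ^ k.natAbs

/-- The harmonic extension operator `E`, determined on Fourier modes by
`E ψ_k (r e^{iθ}) = r^{|k|} e^{ikθ}` for `ψ_k(e^{iθ}) = e^{ikθ}`. For `ψ ∈ C⁴(𝕊¹)` the series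
converges absolutely at every point of the closed unit disc. -/
def harmonicExt (ψ : Circle → ℂ) (z : ℂ) : ℂ :=
  ∑' k : ℤ, circleCoeff ψ k * discMode k z

/-- The harmonic extension of a real-valued `ψ`; it is real-valued, see
`harmonicExt_ofReal_im`. -/
def harmonicExtReal (ψ : Circle → ℝ) (z : ℂ) : ℝ :=
  (harmonicExt (fun w => (ψ w : ℂ)) z).re

/-- `Φ^φ(z) = φ(z) z + (iz · ∇φ(z)) iz` for `z` in the closed unit disc. The derivative is the one
relative to the closed disc, so that it also makes sense on the unit circle for `φ` of class `C¹`
up to the boundary. -/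
def entropyOf (φ : ℂ → ℝ) (z : ℂ) : ℂ :=
  (φ z : ℂ) * z +
    (fderivWithin ℝ φ (Metric.closedBall 0 1) z (Complex.I * z) : ℂ) * (Complex.I * z)

/-- The Fourier multiplier operator `𝒜₁ ψ_k = (ik/2)(k² - 1) ψ_k`. For `ψ ∈ C⁴(𝕊¹)` the series
converges absolutely at every point. -/
def multiplierA₁ (ψ : Circle → ℂ) (w : Circle) : ℂ :=
  ∑' k : ℤ, circleCoeff ψ k * (Complex.I * k / 2 * ((k : ℂ) ^ 2 - 1)) * (w : ℂ) ^ k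

theorem circleCoeff_eq_integral (ψ : Circle → ℂ) (k : ℤ) :
    circleCoeff ψ k = (1 / (2 * π) : ℝ) •
      ∫ t in (0 : ℝ)..(2 * π), Complex.exp (-(k * t * Complex.I)) * ψ (Circle.exp t) := by
  have : Fact (0 < 2 * π) := ⟨Real.two_pi_pos⟩
  unfold circleCoeff
  rw [fourierCoeff_eq_intervalIntegral _ _ 0, zero_add]
  congr 1
  apply intervalIntegral.integral_congr
  intro t _
  have hpi : (π : ℂ) ≠ 0 := by exact_mod_cast Real.pi_ne_zero
  have h1 : AddCircle.toCircle (t : AddCircle (2 * π)) = Circle.exp t := by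
    rw [AddCircle.toCircle_apply_mk]
    congr 1
    field_simp
  simp only [smul_eq_mul, h1, fourier_coe_apply]
  congr 2
  push_cast
  field_simp

theorem discMode_polar (k : ℤ) (r θ : ℝ) :
    discMode k (r * Complex.exp (θ * Complex.I)) =
      (r : ℂ) ^ k.natAbs * Complex.exp (k * θ * Complex.I) := by
  unfold discMode
  split_ifs with h
  · obtain ⟨n, rfl⟩ := Int.eq_ofNat_of_zero_le h
    simp only [Int.natAbs_natCast, mul_pow, ← Complex.exp_nat_mul, Int.cast_natCast, mul_assoc]
  · obtain ⟨n, hn⟩ := Int.eq_ofNat_of_zero_le (a := -k) (by omega)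
    obtain rfl : k = -(n : ℤ) := by omega
    simp only [Int.natAbs_neg, Int.natAbs_natCast, map_mul, Complex.conj_ofReal, mul_pow,
      ← Complex.exp_conj, ← Complex.exp_nat_mul, Complex.conj_I, Int.cast_neg, Int.cast_natCast]
    congr 2
    ring

theorem circleCoeff_ofReal_neg (ψ : Circle → ℝ) (k : ℤ) :
    circleCoeff (fun w => (ψ w : ℂ)) (-k) = conj (circleCoeff (fun w => (ψ w : ℂ)) k) := by
  have : Fact (0 < 2 * π) := ⟨Real.two_pi_pos⟩
  unfold circleCoeff fourierCoeff
  rw [← integral_conj]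
  congr 1
  ext t
  simp

theorem harmonicExt_ofReal_im (ψ : Circle → ℝ) (z : ℂ) :
    (harmonicExt (fun w => (ψ w : ℂ)) z).im = 0 := by
  rw [← Complex.conj_eq_iff_im]
  unfold harmonicExt
  rw [Complex.conj_tsum, ← (Equiv.neg ℤ).tsum_eq]
  congr 1
  ext k
  simp only [Equiv.neg_apply, map_mul, circleCoeff_ofReal_neg, Complex.conj_conj]
  congr 1
  unfold discMode
  rcases lt_trichotomy k 0 with h | h | h
  · simp [h.le, not_le.mpr h]
  · simp [h]
  · simp [h.le, not_le.mpr h]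

end Eikonal

end

/-!
The proof passes to the limit in an exact identity for the mollifications `w = m * ρ_ε`, with
`ε = ε_k`, which are smooth, divergence free and of length at most one.

*The limit.* As `|m| = 1`, the defect `1 - |w|²` is bounded by the mean of `|m(x + z) - m(x)|²`,
while `∇w` is bounded by `ε⁻¹` times the mean of `|m(x + z) - m(x)|`. Hence `(1 - |w|²) |∇w|` is
bounded pointwise by a multiple of `𝒫_m^ε` (`exists_defect_mul_fderiv_le`). The products
`(1 - |w|²) curl w` are therefore dominated by a weakly convergent sequence, and along an
ultrafilter they have a weak limit `λ` with `|λ| ≤ C 𝒫_m`, which lies in `L^p_loc`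
(`exists_weak_limit_of_dominated`, `exists_isDefectCurlLimit`).

*One Fourier mode.* For `φ(z) = Re (c z^k)` the entropy `Φ^φ` is a polynomial in `z` and `conj z`.
With `∂` the derivative with respect to `conj z`, a computation gives, for divergence-free `w`,
`div Φ^φ(w) = k (k + 1) Re (c w^(k-1) ∂|w|²)`. Integrating by parts twice, this becomes
`(k (k² - 1) / 2) Re (i c w^k) (1 - |w|²) curl w`, up to the divergence of a field that vanishes for
`|w| = 1` and a term of the form `(1 - |w|²)² ∇w` with bounded coefficients
(`div_mode_add_corrector`). The first error disappears in the limit by dominated convergence, the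
second because it is a dominated sequence times `1 - |w|² → 0`
(`tendsto_integral_mul_zero_of_dominated`). So
`div Φ^φ(m) = (k (k² - 1) / 2) Re (i c m^k) λ`, that is `𝒜₁` of `Re (c e^{ikt})` at `m`, times `λ`
(`integral_fderiv_modeEntropy_add_two`, `hasTestDiv_circleEntropy`).

*Conclusion.* Only the values of an entropy on the unit circle matter for `m`. There `Σ₁` and `Σ₂`
are entropies of mode `2`, with `c = -i/3` and `c = -1/3`, so that `div Σ(m) = λ e^{2iθ}` and
`λ = e^{2iθ} · div Σ(m)`. For general `ψ` of class `C⁴` the values of `Φ^{Eψ}` on the circle are the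
sum of those of the modes of `ψ` (`hasSum_circleEntropy`). Since the Fourier coefficients satisfy
`∑ |c_k| |k|³ < ∞` (`IsC4.summable_coeff`), the identity may be summed over the modes
(`hasLpLocDiv_superposition`). The same summability allows `𝒜₁ψ` to be computed by differentiating
the Fourier series termwise (`IsC4.multiplierA₁_eq`).
-/

noncomputable section

namespace Eikonal

/-! ### Weak limits of dominated sequences -/

section WeakLimit

variable {X : Type*} [MeasurableSpace X] {μ : Measure X}

theorem abs_integral_le_of_ae_abs_le {u g : X → ℝ} (hg : Integrable g μ)
    (h : ∀ᵐ x ∂μ, |u x| ≤ g x) : |∫ x, u x ∂μ| ≤ ∫ x, g x ∂μ :=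
  norm_integral_le_of_norm_le (f := u) hg h

/-- A sequence dominated by a sequence that converges weakly in `L¹` has a weak limit along every
ultrafilter. The limits of the integrals over sets form a signed measure, and the weak limit is its
Radon–Nikodym density; this takes the place of the Dunford–Pettis theorem. -/
theorem exists_weak_limit_of_dominated [IsFiniteMeasure μ] (𝒰 : Ultrafilter ℕ)
    {q f : ℕ → X → ℝ} {F : X → ℝ}
    (hq : ∀ᶠ k in (𝒰 : Filter ℕ), Integrable (q k) μ)
    (hf : ∀ᶠ k in (𝒰 : Filter ℕ), Integrable (f k) μ) (hF : Integrable F μ)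
    (hqf : ∀ᶠ k in (𝒰 : Filter ℕ), ∀ᵐ x ∂μ, |q k x| ≤ f k x)
    (hfF : ∀ A, MeasurableSet A →
      Tendsto (fun k => ∫ x in A, f k x ∂μ) 𝒰 (𝓝 (∫ x in A, F x ∂μ))) :
    ∃ g : X → ℝ, Measurable g ∧ Integrable g μ ∧ (∀ᵐ x ∂μ, |g x| ≤ F x) ∧
      ∀ A, MeasurableSet A →
        Tendsto (fun k => ∫ x in A, q k x ∂μ) 𝒰 (𝓝 (∫ x in A, g x ∂μ)) := by
  have bound : ∀ A, ∀ᶠ k in (𝒰 : Filter ℕ), |∫ x in A, q k x ∂μ| ≤ ∫ x in A, f k x ∂μ := by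
    intro A
    filter_upwards [hf, hqf] with k hfk hk
    exact abs_integral_le_of_ae_abs_le hfk.integrableOn (ae_restrict_of_ae hk)
  have hex : ∀ A, ∃ L : ℝ, MeasurableSet A →
      Tendsto (fun k => ∫ x in A, q k x ∂μ) 𝒰 (𝓝 L) := by
    intro A
    by_cases hA : MeasurableSet A
    · have h1 : ∀ᶠ k in (𝒰 : Filter ℕ),
          ∫ x in A, q k x ∂μ ∈ Icc (-((∫ x in A, F x ∂μ) + 1)) ((∫ x in A, F x ∂μ) + 1) := by
        filter_upwards [bound A, (hfF A hA).eventually_le_const (lt_add_one _)] with k h1 h2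
        exact abs_le.mp (h1.trans h2)
      obtain ⟨L, -, hL⟩ := isCompact_Icc.ultrafilter_le_nhds (𝒰.map _)
        (le_principal_iff.mpr h1)
      exact ⟨L, fun _ => hL⟩
    · exact ⟨0, fun h => absurd h hA⟩
  choose L hL using hex
  have hLF : ∀ A, MeasurableSet A → |L A| ≤ ∫ x in A, F x ∂μ := fun A hA =>
    le_of_tendsto_of_tendsto (hL A hA).abs (hfF A hA) (bound A)
  classical
  let ν : SignedMeasure X :=
    { measureOf' := fun A => if MeasurableSet A then L A else 0
      empty' := by
        have := hLF ∅ MeasurableSet.empty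
        simpa using this
      not_measurable' := fun A hA => if_neg hA
      m_iUnion' := by
        intro A hA hdisj
        have hU := MeasurableSet.iUnion hA
        simp only [hA, hU, if_true]
        have hFs : HasSum (fun i => ∫ x in A i, F x ∂μ) (∫ x in ⋃ i, A i, F x ∂μ) :=
          hasSum_integral_iUnion hA hdisj hF.integrableOn
        have key : ∀ s : Finset ℕ, |(∑ i ∈ s, L (A i)) - L (⋃ i, A i)| ≤
            (∫ x in ⋃ i, A i, F x ∂μ) - ∑ i ∈ s, ∫ x in A i, F x ∂μ := by
          intro s
          have split : ∀ u : X → ℝ, Integrable u μ →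
              ∫ x in (⋃ i, A i) \ ⋃ i ∈ s, A i, u x ∂μ =
                (∫ x in ⋃ i, A i, u x ∂μ) - ∑ i ∈ s, ∫ x in A i, u x ∂μ := by
            intro u hu
            rw [setIntegral_sdiff (Finset.measurableSet_biUnion s fun i _ => hA i)
              hu.integrableOn (iUnion₂_subset fun i _ => subset_iUnion A i),
              integral_biUnion_finset s (fun i _ => hA i) (fun i _ j _ hij => hdisj hij)
              fun i _ => hu.integrableOn]
          refine le_of_tendsto_of_tendsto
            ((tendsto_finsetSum s fun i _ => hL (A i) (hA i)).sub (hL _ hU)).abs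
            ((hfF _ hU).sub (tendsto_finsetSum s fun i _ => hfF (A i) (hA i))) ?_
          filter_upwards [bound ((⋃ i, A i) \ ⋃ i ∈ s, A i), hq, hf] with k h1 h2 h3
          rw [split _ h2, split _ h3] at h1
          rw [abs_sub_comm]
          exact h1
        rw [HasSum, tendsto_iff_norm_sub_tendsto_zero]
        refine squeeze_zero (fun s => norm_nonneg _) key ?_
        simpa using (tendsto_const_nhds (x := ∫ x in ⋃ i, A i, F x ∂μ)).sub hFs }
  have hν : ∀ A, MeasurableSet A → ν A = L A := fun A hA => if_pos hA
  have hac : ν ≪ᵥ μ.toENNRealVectorMeasure := by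
    refine VectorMeasure.AbsolutelyContinuous.mk fun A hA h0 => ?_
    rw [Measure.toENNRealVectorMeasure_apply_measurable hA] at h0
    rw [hν A hA]
    have := hLF A hA
    rw [Measure.restrict_eq_zero.mpr h0, integral_zero_measure] at this
    exact abs_nonpos_iff.mp this
  have hd := SignedMeasure.withDensityᵥ_rnDeriv_eq ν μ hac
  have hgi : Integrable (ν.rnDeriv μ) μ := SignedMeasure.integrable_rnDeriv ν μ
  have hg : ∀ A, MeasurableSet A → ∫ x in A, ν.rnDeriv μ x ∂μ = L A := by
    intro A hA
    rw [← withDensityᵥ_apply hgi hA, hd, hν A hA]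
  refine ⟨ν.rnDeriv μ, SignedMeasure.measurable_rnDeriv ν μ, hgi, ?_, fun A hA => ?_⟩
  · have h1 : ν.rnDeriv μ ≤ᵐ[μ] F := ae_le_of_forall_setIntegral_le hgi hF fun A hA _ => by
      rw [hg A hA]
      exact (le_abs_self _).trans (hLF A hA)
    have h2 : (fun x => -ν.rnDeriv μ x) ≤ᵐ[μ] F :=
      ae_le_of_forall_setIntegral_le hgi.neg hF fun A hA _ => by
        rw [integral_neg, hg A hA]
        exact (neg_le_abs _).trans (hLF A hA)
    filter_upwards [h1, h2] with x h1 h2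
    exact abs_le'.mpr ⟨h1, h2⟩
  · rw [hg A hA]
    exact hL A hA

theorem exists_simpleFunc_abs_sub_le {h : X → ℝ} (hh : Measurable h) {B : ℝ}
    (hB : ∀ x, |h x| ≤ B) {η : ℝ} (hη : 0 < η) :
    ∃ φ : SimpleFunc X ℝ, ∀ x, |h x - φ x| ≤ η := by
  have hm : Measurable fun x => (⌊h x / η⌋ : ℤ) := (hh.div_const η).floor
  have hfin : (range fun x => (⌊h x / η⌋ : ℤ)).Finite := by
    refine (Set.finite_Icc ⌊-B / η⌋ ⌊B / η⌋).subset ?_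
    rintro _ ⟨x, rfl⟩
    have := abs_le.mp (hB x)
    exact ⟨Int.floor_mono (by gcongr; exact this.1), Int.floor_mono (by gcongr; exact this.2)⟩
  let φ : SimpleFunc X ℤ := ⟨_, fun z => hm (measurableSet_singleton z), hfin⟩
  refine ⟨φ.map fun n : ℤ => (n : ℝ) * η, fun x => ?_⟩
  have h1 := Int.floor_le (h x / η)
  have h2 := Int.lt_floor_add_one (h x / η)
  rw [le_div_iff₀ hη] at h1
  rw [div_lt_iff₀ hη] at h2
  change |h x - (⌊h x / η⌋ : ℤ) * η| ≤ η
  rw [abs_le]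
  constructor <;> linarith

theorem tendsto_integral_mul_of_tendsto_setIntegral {ι : Type*} {l : Filter ι}
    {q : ι → X → ℝ} {g : X → ℝ} {C : ℝ}
    (hq : ∀ᶠ k in l, Integrable (q k) μ) (hC : ∀ᶠ k in l, ∫ x, |q k x| ∂μ ≤ C)
    (hg : Integrable g μ)
    (hlim : ∀ A, MeasurableSet A →
      Tendsto (fun k => ∫ x in A, q k x ∂μ) l (𝓝 (∫ x in A, g x ∂μ)))
    {h : X → ℝ} (hh : Measurable h) {B : ℝ} (hB : ∀ x, |h x| ≤ B) :
    Tendsto (fun k => ∫ x, q k x * h x ∂μ) l (𝓝 (∫ x, g x * h x ∂μ)) := by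
  have hbdd : ∀ (u : X → ℝ), Integrable u μ → ∀ φ : SimpleFunc X ℝ,
      Integrable (fun x => u x * φ x) μ := by
    intro u hu φ
    obtain ⟨c, hc⟩ := φ.exists_forall_norm_le
    exact hu.mul_bdd (c := c) φ.aestronglyMeasurable (Eventually.of_forall hc)
  have hsimple : ∀ φ : SimpleFunc X ℝ,
      Tendsto (fun k => ∫ x, q k x * φ x ∂μ) l (𝓝 (∫ x, g x * φ x ∂μ)) := by
    intro φ
    induction φ using SimpleFunc.induction with
    | const c hs =>
      rename_i s
      have e : ∀ u : X → ℝ, ∫ x, u x * (SimpleFunc.piecewise s hs (SimpleFunc.const X c)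
          (SimpleFunc.const X 0)) x ∂μ = (∫ x in s, u x ∂μ) * c := by
        intro u
        rw [← integral_mul_const, ← integral_indicator hs]
        congr 1
        ext x
        by_cases hx : x ∈ s <;> simp [hx]
      simp only [e]
      exact (hlim s hs).mul_const c
    | add hdisj h1 h2 =>
      rename_i φ₁ φ₂
      have e : ∀ u : X → ℝ, Integrable u μ → ∫ x, u x * (φ₁ + φ₂) x ∂μ =
          (∫ x, u x * φ₁ x ∂μ) + ∫ x, u x * φ₂ x ∂μ := by
        intro u hu
        rw [← integral_add (hbdd u hu φ₁) (hbdd u hu φ₂)]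
        simp [mul_add]
      rw [e g hg]
      refine (h1.add h2).congr' ?_
      filter_upwards [hq] with k hk
      exact (e _ hk).symm
  set D := |C| + (∫ x, |g x| ∂μ) + 1 with hD
  have hg0 : 0 ≤ ∫ x, |g x| ∂μ := integral_nonneg fun x => abs_nonneg _
  have hDpos : 0 < D := by positivity
  rw [Metric.tendsto_nhds]
  intro δ hδ
  obtain ⟨φ, hφ⟩ := exists_simpleFunc_abs_sub_le hh hB (η := δ / (4 * D)) (by positivity)
  have herr : ∀ u : X → ℝ, Integrable u μ → (∫ x, |u x| ∂μ) ≤ D →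
      |(∫ x, u x * h x ∂μ) - ∫ x, u x * φ x ∂μ| ≤ δ / 4 := by
    intro u hu huD
    have hi : Integrable (fun x => u x * h x) μ :=
      hu.mul_bdd (c := B) hh.aestronglyMeasurable (Eventually.of_forall hB)
    rw [← integral_sub hi (hbdd u hu φ)]
    calc |∫ x, u x * h x - u x * φ x ∂μ| ≤ ∫ x, |u x| * (δ / (4 * D)) ∂μ := by
          refine abs_integral_le_of_ae_abs_le (hu.abs.mul_const _) (Eventually.of_forall fun x => ?_)
          rw [← mul_sub, abs_mul]
          gcongr
          exact hφ x
      _ = (∫ x, |u x| ∂μ) * (δ / (4 * D)) := integral_mul_const _ _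
      _ ≤ D * (δ / (4 * D)) := by gcongr
      _ = δ / 4 := by field_simp
  filter_upwards [hq, hC, (Metric.tendsto_nhds.mp (hsimple φ)) (δ / 4) (by positivity)]
    with k h1 h2 h3
  have e1 := herr _ h1 (h2.trans (by rw [hD]; linarith [le_abs_self C]))
  have e2 := herr _ hg (by rw [hD]; linarith [abs_nonneg C])
  rw [Real.dist_eq] at h3 ⊢
  rw [abs_le] at e1 e2
  rw [abs_lt] at h3 ⊢
  constructor <;> linarith [e1.1, e1.2, e2.1, e2.2, h3.1, h3.2]

/-- The suprema of the tails of `|b k|` decrease to zero almost everywhere, so that they may be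
tested against the weak limit `F`; no uniform integrability of `f` has to be known. -/
theorem tendsto_integral_mul_zero_of_dominated [IsFiniteMeasure μ]
    {q f b : ℕ → X → ℝ} {F : X → ℝ} {B : ℝ}
    (hf : ∀ᶠ k in atTop, Integrable (f k) μ) (hF : Integrable F μ)
    (hqf : ∀ᶠ k in atTop, ∀ᵐ x ∂μ, |q k x| ≤ f k x)
    (hfF : ∀ h : X → ℝ, Measurable h → (∃ C, ∀ x, |h x| ≤ C) →
      Tendsto (fun k => ∫ x, f k x * h x ∂μ) atTop (𝓝 (∫ x, F x * h x ∂μ)))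
    (hb : ∀ k, Measurable (b k)) (hB : ∀ k x, |b k x| ≤ B)
    (hb0 : ∀ᵐ x ∂μ, Tendsto (fun k => b k x) atTop (𝓝 0)) :
    Tendsto (fun k => ∫ x, q k x * b k x ∂μ) atTop (𝓝 0) := by
  let S : ℕ → X → ℝ := fun N x => ⨆ j : ℕ, |b (N + j) x|
  have hbd : ∀ N x, BddAbove (range fun j : ℕ => |b (N + j) x|) := fun N x =>
    ⟨B, by rintro _ ⟨j, rfl⟩; exact hB _ _⟩
  have hSm : ∀ N, Measurable (S N) := fun N => Measurable.iSup fun j => (hb _).abs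
  have hS0 : ∀ N x, 0 ≤ S N x := fun N x => Real.iSup_nonneg fun j => abs_nonneg _
  have hSB : ∀ N x, |S N x| ≤ B := fun N x => by
    rw [abs_of_nonneg (hS0 N x)]
    exact ciSup_le fun j => hB _ _
  have hSlim : ∀ᵐ x ∂μ, Tendsto (fun N => S N x) atTop (𝓝 0) := by
    filter_upwards [hb0] with x hx
    rw [Metric.tendsto_atTop] at hx ⊢
    intro η hη
    obtain ⟨N, hN⟩ := hx (η / 2) (by positivity)
    refine ⟨N, fun n hn => ?_⟩
    rw [Real.dist_eq, sub_zero, abs_of_nonneg (hS0 n x)]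
    refine (ciSup_le fun j => ?_).trans_lt (half_lt_self hη)
    have := hN (n + j) (by omega)
    rw [Real.dist_eq, sub_zero] at this
    exact this.le
  have hFS : Tendsto (fun N => ∫ x, F x * S N x ∂μ) atTop (𝓝 0) := by
    have := tendsto_integral_of_dominated_convergence (μ := μ) (F := fun N x => F x * S N x)
      (f := fun _ => 0) (fun x => |F x| * B)
      (fun N => hF.aestronglyMeasurable.mul (hSm N).aestronglyMeasurable)
      (hF.abs.mul_const B) (fun N => Eventually.of_forall fun x => by
        rw [Real.norm_eq_abs, abs_mul]
        gcongr
        exact hSB N x) (by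
        filter_upwards [hSlim] with x hx
        simpa using hx.const_mul (F x))
    simpa using this
  rw [Metric.tendsto_nhds]
  intro δ hδ
  obtain ⟨N, hN⟩ := ((Metric.tendsto_nhds.mp hFS) (δ / 2) (by positivity)).exists
  have h2 := (Metric.tendsto_nhds.mp (hfF (S N) (hSm N) ⟨B, hSB N⟩)) (δ / 2) (by positivity)
  filter_upwards [hf, hqf, h2, eventually_ge_atTop N] with k hfk hk hk2 hkN
  have hle : |∫ x, q k x * b k x ∂μ| ≤ ∫ x, f k x * S N x ∂μ := by
    refine abs_integral_le_of_ae_abs_le (hfk.mul_bdd (c := B) (hSm N).aestronglyMeasurable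
      (Eventually.of_forall (hSB N))) ?_
    filter_upwards [hk] with x hx
    rw [abs_mul]
    have hbS : |b k x| ≤ S N x := by
      obtain ⟨j, rfl⟩ := Nat.exists_eq_add_of_le hkN
      exact le_ciSup (hbd N x) j
    exact mul_le_mul hx hbS (abs_nonneg _) ((abs_nonneg _).trans hx)
  rw [Real.dist_eq] at hN hk2 ⊢
  rw [sub_zero] at hN ⊢
  refine hle.trans_lt ?_
  have a1 := (abs_lt.mp hN).2
  have a2 := (abs_lt.mp hk2).2
  linarith

end WeakLimit

/-! ### Mollification -/

/-- A fixed smooth probability density on the plane, supported in the disc of radius `1/2`. -/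
def unitKernel : ℂ → ℝ :=
  (⟨1 / 4, 1 / 2, by norm_num, by norm_num⟩ : ContDiffBump (0 : ℂ)).normed volume

/-- The rescaled density `ε⁻² ρ(·/ε)`, supported in the disc of radius `ε/2`. -/
def kernel (ε : ℝ) (z : ℂ) : ℝ := (ε ^ 2)⁻¹ * unitKernel (ε⁻¹ • z)

/-- The mollification `M * ρ_ε`. -/
def mollify (ε : ℝ) (M : ℂ → ℂ) : ℂ → ℂ :=
  convolution (kernel ε) M (ContinuousLinearMap.lsmul ℝ ℝ) volume

theorem unitKernel_contDiff : ContDiff ℝ (⊤ : ℕ∞) unitKernel := ContDiffBump.contDiff_normed _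

theorem unitKernel_tsupport : tsupport unitKernel ⊆ Metric.closedBall 0 (1 / 2) :=
  (ContDiffBump.tsupport_normed_eq _).subset

theorem unitKernel_hasCompactSupport : HasCompactSupport unitKernel :=
  ContDiffBump.hasCompactSupport_normed _

theorem kernel_contDiff (ε : ℝ) : ContDiff ℝ (⊤ : ℕ∞) (kernel ε) :=
  contDiff_const.mul (unitKernel_contDiff.comp (contDiff_const_smul ε⁻¹))

theorem kernel_nonneg (ε : ℝ) (z : ℂ) : 0 ≤ kernel ε z :=
  mul_nonneg (by positivity) (ContDiffBump.nonneg_normed _ _)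

theorem kernel_tsupport {ε : ℝ} (hε : 0 < ε) : tsupport (kernel ε) ⊆ Metric.closedBall 0 (ε / 2) := by
  refine closure_minimal (fun z hz => ?_) Metric.isClosed_closedBall
  have h1 : unitKernel (ε⁻¹ • z) ≠ 0 := right_ne_zero_of_mul hz
  have h2 := unitKernel_tsupport (subset_tsupport _ h1)
  rw [mem_closedBall_zero_iff, norm_smul, norm_inv, Real.norm_of_nonneg hε.le,
    inv_mul_le_iff₀ hε] at h2
  rw [mem_closedBall_zero_iff]
  linarith

theorem kernel_tsupport_subset_ball {ε : ℝ} (hε : 0 < ε) :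
    tsupport (kernel ε) ⊆ Metric.ball 0 ε :=
  (kernel_tsupport hε).trans (Metric.closedBall_subset_ball (by linarith))

theorem kernel_hasCompactSupport {ε : ℝ} (hε : 0 < ε) : HasCompactSupport (kernel ε) :=
  (isCompact_closedBall _ _).of_isClosed_subset (isClosed_tsupport _) (kernel_tsupport hε)

theorem kernel_integral {ε : ℝ} (hε : 0 < ε) : ∫ z, kernel ε z = 1 := by
  unfold kernel
  rw [integral_const_mul, Measure.integral_comp_inv_smul_of_nonneg _ _ hε.le,
    Complex.finrank_real_complex, unitKernel, ContDiffBump.integral_normed]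
  simp [hε.ne']

theorem kernel_bounds : ∃ C : ℝ, 0 < C ∧ ∀ ε : ℝ, 0 < ε → ∀ z : ℂ,
    kernel ε z ≤ C / ε ^ 2 ∧ ‖fderiv ℝ (kernel ε) z‖ ≤ C / ε ^ 3 := by
  obtain ⟨C₁, h₁⟩ := unitKernel_hasCompactSupport.exists_bound_of_continuous
    unitKernel_contDiff.continuous
  obtain ⟨C₂, h₂⟩ := (unitKernel_hasCompactSupport.fderiv ℝ).exists_bound_of_continuous
    (unitKernel_contDiff.continuous_fderiv (by simp))
  refine ⟨max (max C₁ C₂) 1, by positivity, fun ε hε z => ⟨?_, ?_⟩⟩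
  · have := (le_abs_self _).trans (h₁ (ε⁻¹ • z))
    unfold kernel
    rw [inv_mul_eq_div]
    gcongr
    exact this.trans ((le_max_left _ _).trans (le_max_left _ _))
  · have hd : HasFDerivAt (kernel ε) ((ε ^ 2)⁻¹ • ((fderiv ℝ unitKernel (ε⁻¹ • z)).comp
        (ε⁻¹ • ContinuousLinearMap.id ℝ ℂ))) z := by
      have h0 : HasFDerivAt (fun z : ℂ => ε⁻¹ • z) (ε⁻¹ • ContinuousLinearMap.id ℝ ℂ) z :=
        (hasFDerivAt_id z).const_smul ε⁻¹
      have h1 := ((unitKernel_contDiff.differentiable (by simp)) (ε⁻¹ • z)).hasFDerivAt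
      exact (h1.comp z h0).const_mul ((ε ^ 2)⁻¹)
    rw [hd.fderiv, ContinuousLinearMap.comp_smul, ContinuousLinearMap.comp_id, norm_smul,
      norm_smul, norm_inv, norm_inv, norm_pow, Real.norm_of_nonneg hε.le]
    have := (h₂ (ε⁻¹ • z)).trans ((le_max_right C₁ C₂).trans (le_max_left _ 1))
    calc (ε ^ 2)⁻¹ * (ε⁻¹ * ‖fderiv ℝ unitKernel (ε⁻¹ • z)‖)
        ≤ (ε ^ 2)⁻¹ * (ε⁻¹ * max (max C₁ C₂) 1) := by gcongr
      _ = _ := by field_simp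

/-- The integral of a directional derivative of a compactly supported function vanishes. -/
theorem integral_fderiv_apply_eq_zero {f : ℂ → ℝ} (hf : ContDiff ℝ 1 f)
    (hc : HasCompactSupport f) (v : ℂ) : ∫ z, fderiv ℝ f z v = 0 := by
  have hi : Integrable fun z => fderiv ℝ f z v :=
    ((hf.continuous_fderiv one_ne_zero).clm_apply continuous_const).integrable_of_hasCompactSupport
      (hc.fderiv_apply ℝ v)
  have := integral_mul_fderiv_eq_neg_fderiv_mul_of_integrable (μ := (volume : Measure ℂ))
    (f := fun _ : ℂ => (1 : ℝ)) (g := f) (v := v) (by simp) (by simpa using hi)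
    (by simpa using hf.continuous.integrable_of_hasCompactSupport hc)
    (fun _ _ => differentiableAt_const _) (fun _ _ => hf.differentiable one_ne_zero _)
  simpa using this

section Mollify

variable {M : ℂ → ℂ} {ε : ℝ}

theorem locallyIntegrable_of_norm_le_one (hM : Measurable M) (hM1 : ∀ x, ‖M x‖ ≤ 1) :
    LocallyIntegrable M :=
  (locallyIntegrable_const (1 : ℝ)).mono hM.aestronglyMeasurable
    (Eventually.of_forall fun x => by simpa using hM1 x)

theorem mollify_apply (ε : ℝ) (M : ℂ → ℂ) (x : ℂ) :
    mollify ε M x = ∫ t, kernel ε t • M (x - t) := rfl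

theorem mollify_contDiff (hε : 0 < ε) (hM : Measurable M) (hM1 : ∀ x, ‖M x‖ ≤ 1) :
    ContDiff ℝ (⊤ : ℕ∞) (mollify ε M) :=
  (kernel_hasCompactSupport hε).contDiff_convolution_left _ (kernel_contDiff ε)
    (locallyIntegrable_of_norm_le_one hM hM1)

theorem kernel_fderiv_continuous (ε : ℝ) (v : ℂ) :
    Continuous fun t => fderiv ℝ (kernel ε) t v :=
  ((kernel_contDiff ε).continuous_fderiv (by simp)).clm_apply continuous_const

theorem kernel_fderiv_integrable (hε : 0 < ε) (v : ℂ) :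
    Integrable fun t => fderiv ℝ (kernel ε) t v :=
  (kernel_fderiv_continuous ε v).integrable_of_hasCompactSupport
    ((kernel_hasCompactSupport hε).fderiv_apply ℝ v)

theorem kernel_integrable (hε : 0 < ε) : Integrable (kernel ε) :=
  (kernel_contDiff ε).continuous.integrable_of_hasCompactSupport (kernel_hasCompactSupport hε)

theorem integrable_smul_translate (hM : Measurable M) (hM1 : ∀ x, ‖M x‖ ≤ 1) (x : ℂ)
    {u : ℂ → ℝ} (hu : Integrable u) : Integrable fun t => u t • M (x - t) :=
  hu.smul_bdd 1 (hM.comp (measurable_const.sub measurable_id)).aestronglyMeasurable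
    (Eventually.of_forall fun _ => hM1 _)

theorem mollify_fderiv_apply (hε : 0 < ε) (hM : Measurable M) (hM1 : ∀ x, ‖M x‖ ≤ 1) (x v : ℂ) :
    fderiv ℝ (mollify ε M) x v = ∫ t, (fderiv ℝ (kernel ε) t v) • M (x - t) := by
  have h := (kernel_hasCompactSupport hε).hasFDerivAt_convolution_left
    (ContinuousLinearMap.lsmul ℝ ℝ : ℝ →L[ℝ] ℂ →L[ℝ] ℂ) ((kernel_contDiff ε).of_le (by simp))
    (locallyIntegrable_of_norm_le_one hM hM1) x
  have h' : fderiv ℝ (mollify ε M) x = _ := h.fderiv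
  rw [h', convolution_def, ContinuousLinearMap.integral_apply]
  · rfl
  · exact ((kernel_hasCompactSupport hε).fderiv ℝ).convolutionExists_left _
      ((kernel_contDiff ε).continuous_fderiv (by simp))
      (locallyIntegrable_of_norm_le_one hM hM1) x

theorem mollify_norm_le_one (hε : 0 < ε) (hM1 : ∀ x, ‖M x‖ ≤ 1) (x : ℂ) :
    ‖mollify ε M x‖ ≤ 1 := by
  rw [mollify_apply, ← kernel_integral hε]
  refine norm_integral_le_of_norm_le (kernel_integrable hε) (Eventually.of_forall fun t => ?_)
  rw [norm_smul, Real.norm_of_nonneg (kernel_nonneg ε t)]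
  exact mul_le_of_le_one_right (kernel_nonneg ε t) (hM1 _)

/-- The mollification is divergence free wherever the field is, away from the boundary. -/
theorem mollify_div_eq_zero {Ω : Set ℂ} (hε : 0 < ε) (hM : Measurable M)
    (hM1 : ∀ x, ‖M x‖ ≤ 1)
    (hdiv : ∀ ζ : ℂ → ℝ, ContDiff ℝ (⊤ : ℕ∞) ζ → HasCompactSupport ζ → tsupport ζ ⊆ Ω →
      ∫ x in Ω, fderiv ℝ ζ x (M x) = 0) {x : ℂ} (hx : Metric.closedBall x ε ⊆ Ω) :
    (fderiv ℝ (mollify ε M) x 1).re + (fderiv ℝ (mollify ε M) x Complex.I).im = 0 := by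
  have hi := fun v => integrable_smul_translate hM hM1 x (kernel_fderiv_integrable hε v)
  rw [mollify_fderiv_apply hε hM hM1, mollify_fderiv_apply hε hM hM1,
    ← Complex.reCLM_apply, ← Complex.imCLM_apply,
    ← ContinuousLinearMap.integral_comp_comm _ (hi 1),
    ← ContinuousLinearMap.integral_comp_comm _ (hi Complex.I),
    ← integral_add (Complex.reCLM.integrable_comp (hi 1))
      (Complex.imCLM.integrable_comp (hi Complex.I))]
  have e1 : ∀ t, Complex.reCLM (fderiv ℝ (kernel ε) t 1 • M (x - t)) +
      Complex.imCLM (fderiv ℝ (kernel ε) t Complex.I • M (x - t)) =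
      fderiv ℝ (kernel ε) t (M (x - t)) := by
    intro t
    have : M (x - t) = (M (x - t)).re • (1 : ℂ) + (M (x - t)).im • Complex.I := by
      simp [Complex.re_add_im]
    conv_rhs => rw [this, map_add, map_smul, map_smul]
    simp [mul_comm]
  simp only [e1]
  rw [← integral_sub_left_eq_self _ volume x]
  simp only [sub_sub_cancel]
  set ζ : ℂ → ℝ := fun y => kernel ε (x - y) with hζ
  have hζd : ∀ y, fderiv ℝ ζ y = -fderiv ℝ (kernel ε) (x - y) := by
    intro y
    have h0 : HasFDerivAt (fun y : ℂ => x - y) (-ContinuousLinearMap.id ℝ ℂ) y :=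
      (hasFDerivAt_id y).const_sub x
    have h1 := (((kernel_contDiff ε).differentiable (by simp)) (x - y)).hasFDerivAt
    have h2 : HasFDerivAt ζ _ y := h1.comp y h0
    rw [h2.fderiv]
    ext v
    simp
  have hts : tsupport ζ ⊆ Metric.closedBall x (ε / 2) := by
    refine closure_minimal (fun y hy => ?_) Metric.isClosed_closedBall
    have := kernel_tsupport hε (subset_tsupport _ (show kernel ε (x - y) ≠ 0 from hy))
    rwa [mem_closedBall_zero_iff, ← dist_eq_norm, dist_comm] at this
  have hsub : tsupport ζ ⊆ Ω :=
    hts.trans ((Metric.closedBall_subset_closedBall (by linarith)).trans hx)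
  have h := hdiv ζ ((kernel_contDiff ε).comp (contDiff_const.sub contDiff_id))
    ((isCompact_closedBall _ _).of_isClosed_subset (isClosed_tsupport _) hts) hsub
  rw [setIntegral_eq_integral_of_forall_compl_eq_zero] at h
  · simp only [hζd, neg_apply, integral_neg, neg_eq_zero] at h
    exact h
  · intro y hy
    rw [image_eq_zero_of_notMem_tsupport fun hy' => hy (hsub (tsupport_fderiv_subset ℝ hy'))]
    simp

/-- Pointwise almost everywhere convergence of mollifications, by Lebesgue's differentiation
theorem. -/
theorem ae_tendsto_mollify (hM : Measurable M) (hM1 : ∀ x, ‖M x‖ ≤ 1) {ε : ℕ → ℝ}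
    (hε : ∀ k, 0 < ε k) (hε0 : Tendsto ε atTop (𝓝 0)) :
    ∀ᵐ x, Tendsto (fun k => mollify (ε k) M x) atTop (𝓝 (M x)) := by
  obtain ⟨C, hC, hb⟩ := kernel_bounds
  filter_upwards [IsUnifLocDoublingMeasure.ae_tendsto_average_norm_sub (volume : Measure ℂ)
    (locallyIntegrable_of_norm_le_one hM hM1) 1] with x hx
  have h := hx (fun _ : ℕ => x) ε
    (tendsto_nhdsWithin_iff.mpr ⟨hε0, Eventually.of_forall hε⟩)
    (Eventually.of_forall fun k => by simpa using (hε k).le)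
  rw [tendsto_iff_norm_sub_tendsto_zero]
  refine squeeze_zero (fun k => norm_nonneg _) (fun k => ?_)
    (by simpa using h.const_mul (C * π))
  have hk := hε k
  have e0 : mollify (ε k) M x - M x = ∫ t, kernel (ε k) t • (M (x - t) - M x) := by
    simp only [smul_sub]
    rw [integral_sub (integrable_smul_translate hM hM1 x (kernel_integrable hk))
      ((kernel_integrable hk).smul_const _), integral_smul_const, kernel_integral hk, one_smul,
      mollify_apply]
  have hvol : (volume : Measure ℂ).real (Metric.closedBall x (ε k)) = π * ε k ^ 2 := by
    rw [Measure.real, Complex.volume_closedBall]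
    simp [hk.le, mul_comm]
  have hint : IntegrableOn (fun y => ‖M y - M x‖) (Metric.closedBall x (ε k)) :=
    Measure.integrableOn_of_bounded (M := 2) measure_closedBall_lt_top.ne
      (hM.sub_const _).norm.aestronglyMeasurable
      (Eventually.of_forall fun y => by
        rw [norm_norm]
        linarith [norm_sub_le (M y) (M x), hM1 y, hM1 x])
  have e1 : ‖∫ t, kernel (ε k) t • (M (x - t) - M x)‖ ≤
      ∫ t, (Metric.closedBall x (ε k)).indicator (fun y => C / ε k ^ 2 * ‖M y - M x‖) (x - t) := by
    refine norm_integral_le_of_norm_le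
      ((IntegrableOn.integrable_indicator (hint.const_mul _)
        measurableSet_closedBall).comp_sub_left x)
      (Eventually.of_forall fun t => ?_)
    rw [norm_smul, Real.norm_of_nonneg (kernel_nonneg _ t)]
    by_cases ht : x - t ∈ Metric.closedBall x (ε k)
    · rw [indicator_of_mem ht]
      gcongr
      exact (hb _ hk t).1
    · have : t ∉ tsupport (kernel (ε k)) := fun h' => ht (by
        have := kernel_tsupport hk h'
        rw [mem_closedBall_zero_iff] at this
        rw [Metric.mem_closedBall, dist_eq_norm, sub_sub_cancel_left, norm_neg]
        linarith)
      rw [indicator_of_notMem ht, image_eq_zero_of_notMem_tsupport this, zero_mul]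
  rw [e0]
  refine e1.trans (le_of_eq ?_)
  rw [integral_sub_left_eq_self _ volume x, integral_indicator measurableSet_closedBall,
    integral_const_mul, setAverage_eq, hvol, smul_eq_mul]
  field_simp

/-- `(∫ f)(∫ f²) ≤ μ(X) ∫ f³`, from `a b² ≤ (a³ + 2 b³) / 3`. -/
theorem integral_mul_integral_sq_le {X : Type*} [MeasurableSpace X] {μ : Measure X}
    [IsFiniteMeasure μ] {f : X → ℝ} (hf : Measurable f) (h0 : ∀ x, 0 ≤ f x) {B : ℝ}
    (hB : ∀ x, f x ≤ B) :
    (∫ x, f x ∂μ) * ∫ x, f x ^ 2 ∂μ ≤ μ.real univ * ∫ x, f x ^ 3 ∂μ := by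
  have hi : ∀ n : ℕ, Integrable (fun x => f x ^ n) μ := fun n =>
    Integrable.of_bound (C := B ^ n) (hf.pow_const n).aestronglyMeasurable
      (Eventually.of_forall fun x => by
        rw [norm_pow, Real.norm_of_nonneg (h0 x)]
        exact pow_le_pow_left₀ (h0 x) (hB x) n)
  have hi1 : Integrable f μ := by simpa using hi 1
  set I₃ := ∫ x, f x ^ 3 ∂μ
  have step : ∀ y, (∫ x, f x ∂μ) * f y ^ 2 ≤ (I₃ + μ.real univ * (2 * f y ^ 3)) / 3 := by
    intro y
    have : ∫ x, f x * f y ^ 2 ∂μ ≤ ∫ x, (f x ^ 3 + 2 * f y ^ 3) / 3 ∂μ :=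
      integral_mono (hi1.mul_const _) (((hi 3).add (integrable_const _)).div_const 3) fun x => by
        have := mul_nonneg (add_nonneg (h0 x) (mul_nonneg zero_le_two (h0 y)))
          (sq_nonneg (f x - f y))
        change f x * f y ^ 2 ≤ (f x ^ 3 + 2 * f y ^ 3) / 3
        nlinarith
    rwa [integral_mul_const, integral_div, integral_add (hi 3) (integrable_const _),
      integral_const, smul_eq_mul] at this
  have := integral_mono ((hi 2).const_mul _)
    (((integrable_const I₃).add (((hi 3).const_mul 2).const_mul (μ.real univ))).div_const 3) step
  rw [integral_const_mul] at this
  refine this.trans (le_of_eq ?_)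
  simp only [Pi.add_apply]
  rw [integral_div, integral_add (integrable_const _) (((hi 3).const_mul 2).const_mul _),
    integral_const, integral_const_mul, integral_const_mul, smul_eq_mul]
  ring

/-- The commutator estimate: the product of the defect `1 - |M * ρ_ε|²`, quadratic in the
increments, with the gradient of `M * ρ_ε`, linear in them, is controlled pointwise by the cubic
increment. -/
theorem exists_defect_mul_fderiv_le : ∃ C : ℝ, 0 < C ∧ ∀ (M : ℂ → ℂ), Measurable M →
    (∀ x, ‖M x‖ ≤ 1) → ∀ ε : ℝ, 0 < ε → ∀ x : ℂ, ‖M x‖ = 1 →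
    (∀ᵐ t, t ∈ Metric.ball (0 : ℂ) ε → ‖M (x - t)‖ = 1) → ∀ v : ℂ,
    (1 - ‖mollify ε M x‖ ^ 2) * ‖fderiv ℝ (mollify ε M) x v‖ ≤
      C * ‖v‖ * cubicIncrement M ε x := by
  obtain ⟨C, hC, hb⟩ := kernel_bounds
  refine ⟨C ^ 2 * π, by positivity, fun M hM hM1 ε hε x hx hball v => ?_⟩
  set B := Metric.ball (0 : ℂ) ε
  set f : ℂ → ℝ := fun t => ‖M (x - t) - M x‖ with hf
  have hMx : Measurable fun t => M (x - t) := hM.comp (measurable_const.sub measurable_id)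
  have hfm : Measurable f := (hMx.sub_const _).norm
  have hf0 : ∀ t, 0 ≤ f t := fun t => norm_nonneg _
  have hf2 : ∀ t, f t ≤ 2 := fun t => by
    have := norm_sub_le (M (x - t)) (M x)
    linarith [hM1 (x - t), hM1 x]
  have hfi : ∀ n : ℕ, IntegrableOn (fun t => f t ^ n) B := fun n =>
    Measure.integrableOn_of_bounded (M := 2 ^ n) measure_ball_lt_top.ne
      (hfm.pow_const n).aestronglyMeasurable (Eventually.of_forall fun t => by
        rw [norm_pow, Real.norm_of_nonneg (hf0 t)]
        exact pow_le_pow_left₀ (hf0 t) (hf2 t) n)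
  have hsupp : ∀ t, t ∉ B → kernel ε t = 0 := fun t ht =>
    image_eq_zero_of_notMem_tsupport fun h => ht (kernel_tsupport_subset_ball hε h)
  have hsupp' : ∀ t, t ∉ B → fderiv ℝ (kernel ε) t = 0 := fun t ht =>
    image_eq_zero_of_notMem_tsupport fun h =>
      ht (kernel_tsupport_subset_ball hε (tsupport_fderiv_subset ℝ h))
  have hgrad : ‖fderiv ℝ (mollify ε M) x v‖ ≤ C / ε ^ 3 * ‖v‖ * ∫ t in B, f t := by
    have e : fderiv ℝ (mollify ε M) x v =
        ∫ t, (fderiv ℝ (kernel ε) t v) • (M (x - t) - M x) := by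
      simp only [smul_sub]
      rw [integral_sub (integrable_smul_translate hM hM1 x (kernel_fderiv_integrable hε v))
        ((kernel_fderiv_integrable hε v).smul_const _), integral_smul_const,
        integral_fderiv_apply_eq_zero ((kernel_contDiff ε).of_le (by simp))
          (kernel_hasCompactSupport hε), zero_smul, sub_zero, mollify_fderiv_apply hε hM hM1]
    rw [e, ← integral_const_mul, ← integral_indicator measurableSet_ball]
    have hf1 : IntegrableOn f B := by simpa using hfi 1
    refine norm_integral_le_of_norm_le
      (IntegrableOn.integrable_indicator (hf1.const_mul _) measurableSet_ball)
      (Eventually.of_forall fun t => ?_)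
    by_cases ht : t ∈ B
    · rw [indicator_of_mem ht, norm_smul]
      gcongr
      exact (ContinuousLinearMap.le_opNorm _ _).trans (by gcongr; exact (hb ε hε t).2)
    · rw [indicator_of_notMem ht, hsupp' t ht]
      simp
  have hdef : 1 - ‖mollify ε M x‖ ^ 2 ≤ C / ε ^ 2 * ∫ t in B, f t ^ 2 := by
    set w := mollify ε M x
    have hwx : 2 - 2 * inner ℝ (M x) w = ∫ t, kernel ε t * (2 - 2 * inner ℝ (M x) (M (x - t))) := by
      have hi := integrable_smul_translate hM hM1 x (kernel_integrable hε)
      have e1 : inner ℝ (M x) w = ∫ t, kernel ε t * inner ℝ (M x) (M (x - t)) := by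
        rw [show w = ∫ t, kernel ε t • M (x - t) from mollify_apply _ _ _, ← integral_inner hi]
        simp only [real_inner_smul_right]
      have hi' : Integrable fun t => kernel ε t * inner ℝ (M x) (M (x - t)) := by
        simpa only [real_inner_smul_right] using hi.const_inner (𝕜 := ℝ) (M x)
      rw [e1, ← integral_const_mul]
      nth_rewrite 1 [show (2 : ℝ) = ∫ t, kernel ε t * 2 by
        rw [integral_mul_const, kernel_integral hε, one_mul]]
      rw [← integral_sub ((kernel_integrable hε).mul_const 2) (hi'.const_mul 2)]
      congr 1
      ext t
      ring
    have h1 : 1 - ‖w‖ ^ 2 ≤ 2 - 2 * inner ℝ (M x) w := by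
      have := norm_sub_sq_real (M x) w
      have := sq_nonneg ‖M x - w‖
      rw [hx] at *
      linarith
    refine h1.trans ?_
    rw [hwx, ← integral_const_mul, ← integral_indicator measurableSet_ball]
    refine (le_abs_self _).trans (abs_integral_le_of_ae_abs_le
      (IntegrableOn.integrable_indicator ((hfi 2).const_mul _) measurableSet_ball) ?_)
    filter_upwards [hball] with t ht
    by_cases htB : t ∈ B
    · rw [indicator_of_mem htB]
      have e : 2 - 2 * inner ℝ (M x) (M (x - t)) = f t ^ 2 := by
        have := norm_sub_sq_real (M (x - t)) (M x)
        rw [hx, ht htB, real_inner_comm] at this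
        rw [hf]
        linarith
      rw [e, abs_of_nonneg (mul_nonneg (kernel_nonneg _ _) (sq_nonneg _))]
      gcongr
      exact (hb ε hε t).1
    · rw [indicator_of_notMem htB, hsupp t htB]
      simp
  have hcub : cubicIncrement M ε x = (ε ^ 3)⁻¹ * ∫ t in B, f t ^ 3 := by
    unfold cubicIncrement
    congr 1
    rw [← integral_indicator measurableSet_ball, ← integral_indicator measurableSet_ball,
      ← integral_neg_eq_self]
    congr 1
    ext t
    by_cases ht : t ∈ B
    · have : -t ∈ B := by simpa [B] using ht
      rw [indicator_of_mem ht, indicator_of_mem this]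
      simp only [hf, sub_eq_add_neg]
    · have : -t ∉ B := by simpa [B] using ht
      rw [indicator_of_notMem ht, indicator_of_notMem this]
  have hvol : (volume.restrict B).real univ = π * ε ^ 2 := by
    rw [Measure.real, Measure.restrict_apply_univ, Complex.volume_ball]
    simp [hε.le, mul_comm]
  have : IsFiniteMeasure (volume.restrict B) :=
    isFiniteMeasure_restrict.mpr measure_ball_lt_top.ne
  have hprod := integral_mul_integral_sq_le (μ := volume.restrict B) hfm hf0 hf2
  rw [hvol] at hprod
  have hw1 := mollify_norm_le_one hε hM1 x
  have hI1 : 0 ≤ ∫ t in B, f t := integral_nonneg hf0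
  calc (1 - ‖mollify ε M x‖ ^ 2) * ‖fderiv ℝ (mollify ε M) x v‖
      ≤ (C / ε ^ 2 * ∫ t in B, f t ^ 2) * (C / ε ^ 3 * ‖v‖ * ∫ t in B, f t) :=
        mul_le_mul hdef hgrad (norm_nonneg _)
          (mul_nonneg (by positivity) (integral_nonneg fun t => sq_nonneg _))
    _ = C ^ 2 / ε ^ 5 * ‖v‖ * ((∫ t in B, f t) * ∫ t in B, f t ^ 2) := by
        field_simp
    _ ≤ C ^ 2 / ε ^ 5 * ‖v‖ * (π * ε ^ 2 * ∫ t in B, f t ^ 3) := by gcongr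
    _ = _ := by
        rw [hcub]
        field_simp

end Mollify

/-! ### Entropies of a single Fourier mode -/

/-- The harmonic entropy `Φ^φ` of `φ(z) = Re (c z ^ k)`, written as a polynomial in `z` and
`conj z`. -/
def modeEntropy (k : ℕ) (c z : ℂ) : ℂ :=
  ((1 - k) * (c * z ^ (k + 1)) + (1 + k) * (conj c * (z * conj z ^ k))) / 2

/-- A vector field vanishing on the unit circle which, added to `modeEntropy (n + 2) c`, removes
from its divergence along divergence-free fields `w` every term that is only linear in
`1 - ‖w‖ ^ 2` and is not a multiple of the curl of `w`. -/
def modeCorrector (n : ℕ) (c z : ℂ) : ℂ :=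
  (n + 2) * (n + 3) / 2 * (conj c * conj z ^ (n + 1) *
    ((1 - z * conj z) + (n + 1) / 2 * (1 - z * conj z) ^ 2))

/-- The curl of `w`. -/
def curl (w : ℂ → ℂ) (x : ℂ) : ℝ := (fderiv ℝ w x 1).im - (fderiv ℝ w x Complex.I).re

/-- The Wirtinger derivative of `w` with respect to `conj z`. -/
def dbar (w : ℂ → ℂ) (x : ℂ) : ℂ := (fderiv ℝ w x 1 + Complex.I * fderiv ℝ w x Complex.I) / 2

theorem modeEntropy_contDiff (k : ℕ) (c : ℂ) : ContDiff ℝ (⊤ : ℕ∞) (modeEntropy k c) := by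
  have h : ContDiff ℝ (⊤ : ℕ∞) fun z : ℂ => conj z := Complex.conjCLE.contDiff
  unfold modeEntropy
  fun_prop

theorem modeCorrector_contDiff (n : ℕ) (c : ℂ) : ContDiff ℝ (⊤ : ℕ∞) (modeCorrector n c) := by
  have h : ContDiff ℝ (⊤ : ℕ∞) fun z : ℂ => conj z := Complex.conjCLE.contDiff
  unfold modeCorrector
  fun_prop

theorem hasDerivAt_mode_add_corrector (n : ℕ) (c : ℂ) {f : ℝ → ℂ} {a : ℂ} {t : ℝ}
    (hf : HasDerivAt f a t) :
    HasDerivAt (fun τ => modeEntropy (n + 2) c (f τ) + modeCorrector n c (f τ))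
      ((-(n + 1) * (c * ((n + 3) * f t ^ n * f t ^ 2 * a)) +
        (n + 3) * (conj c * (a * (conj (f t) ^ n * conj (f t) ^ 2) +
          f t * ((n + 2) * conj (f t) ^ n * conj (f t) * conj a)))) / 2 +
      (n + 2) * (n + 3) / 2 * (conj c *
        ((n + 1) * conj (f t) ^ n * conj a *
            ((1 - f t * conj (f t)) + (n + 1) / 2 * (1 - f t * conj (f t)) ^ 2) +
          conj (f t) ^ n * conj (f t) *
            ((1 + (n + 1) * (1 - f t * conj (f t))) *
              (-(a * conj (f t) + f t * conj a)))))) t := by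
  have hc : HasDerivAt (fun τ => conj (f τ)) (conj a) t := hf.star
  have hs := (hf.mul hc).const_sub 1
  have h1 := (((hf.pow (n + 2 + 1)).const_mul c).const_mul (1 - ((n + 2 : ℕ) : ℂ))).add
    (((hf.mul (hc.pow (n + 2))).const_mul (conj c)).const_mul (1 + ((n + 2 : ℕ) : ℂ)))
  have h2 := (((hc.pow (n + 1)).const_mul (conj c)).mul
    (hs.add ((hs.pow 2).const_mul (((n : ℂ) + 1) / 2)))).const_mul (((n : ℂ) + 2) * (n + 3) / 2)
  refine ((h1.div_const 2).add h2).congr_deriv ?_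
  simp only [Pi.mul_apply, Pi.pow_apply, Nat.cast_add, Nat.cast_one,
    Nat.add_one_sub_one, show n + 2 - 1 = n + 1 by omega, pow_succ,
    Pi.add_apply, Nat.cast_ofNat]
  ring

theorem mode_divergence_algebra (n : ℝ) (c z u A B : ℂ) (h : A.re + B.im = 0) (E : ℂ → ℂ)
    (hE : ∀ a, E a = (-(n + 1) * (c * ((n + 3) * u * z ^ 2 * a)) +
        (n + 3) * (conj c * (a * (conj u * conj z ^ 2) +
          z * ((n + 2) * conj u * conj z * conj a)))) / 2 +
      (n + 2) * (n + 3) / 2 * (conj c *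
        ((n + 1) * conj u * conj a *
            ((1 - z * conj z) + (n + 1) / 2 * (1 - z * conj z) ^ 2) +
          conj u * conj z *
            ((1 + (n + 1) * (1 - z * conj z)) * (-(a * conj z + z * conj a)))))) :
    (E A).re + (E B).im = (n + 1) * (n + 2) * (n + 3) / 2 *
      ((Complex.I * c * (u * z ^ 2)).re * (A.im - B.re) * (1 - ‖z‖ ^ 2) +
        (n + 3) * (c * u * ((A + Complex.I * B) / 2)).re * (1 - ‖z‖ ^ 2) ^ 2) := by
  obtain ⟨a₁, a₂⟩ := A
  obtain ⟨b₁, b₂⟩ := B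
  obtain ⟨x, y⟩ := z
  obtain ⟨u₁, u₂⟩ := u
  obtain ⟨c₁, c₂⟩ := c
  obtain rfl : b₂ = -a₁ := by simp only at h; linarith
  rw [hE, hE, ← Complex.normSq_eq_norm_sq, Complex.normSq_mk]
  simp only [Complex.add_re, Complex.add_im, Complex.mul_re, Complex.mul_im, Complex.sub_re,
    Complex.sub_im, Complex.neg_re, Complex.neg_im, Complex.conj_re, Complex.conj_im,
    Complex.one_re, Complex.one_im, Complex.ofReal_re, Complex.ofReal_im, Complex.I_re,
    Complex.I_im, pow_two, Complex.div_ofNat_re, Complex.div_ofNat_im, Complex.re_ofNat,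
    Complex.im_ofNat]
  ring

/-- For a divergence-free field `w` the divergence of the corrected entropy of mode `k = n + 2`
consists of the curl term and a term quadratic in `1 - ‖w‖ ^ 2`. -/
theorem div_mode_add_corrector (n : ℕ) (c : ℂ) {w : ℂ → ℂ} {x : ℂ}
    (hw : DifferentiableAt ℝ w x)
    (hdiv : (fderiv ℝ w x 1).re + (fderiv ℝ w x Complex.I).im = 0) :
    (fderiv ℝ (fun y => modeEntropy (n + 2) c (w y) + modeCorrector n c (w y)) x 1).re +
      (fderiv ℝ (fun y => modeEntropy (n + 2) c (w y) + modeCorrector n c (w y)) x Complex.I).im =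
    (n + 1) * (n + 2) * (n + 3) / 2 *
      ((Complex.I * c * w x ^ (n + 2)).re * curl w x * (1 - ‖w x‖ ^ 2) +
        (n + 3) * (c * w x ^ n * dbar w x).re * (1 - ‖w x‖ ^ 2) ^ 2) := by
  have hG : DifferentiableAt ℝ
      (fun y => modeEntropy (n + 2) c (w y) + modeCorrector n c (w y)) x :=
    (((modeEntropy_contDiff (n + 2) c).differentiable (by simp) _).comp x hw).add
      (((modeCorrector_contDiff n c).differentiable (by simp) _).comp x hw)
  have hl : ∀ v : ℂ, HasDerivAt (fun t : ℝ => x + t • v) v 0 := fun v => by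
    simpa using ((hasDerivAt_id (0 : ℝ)).smul_const v).const_add x
  have hcurve : ∀ (F : ℂ → ℂ), DifferentiableAt ℝ F x → ∀ v : ℂ,
      HasDerivAt (fun t : ℝ => F (x + t • v)) (fderiv ℝ F x v) 0 := fun F hF v => by
    have hF' : HasFDerivAt F (fderiv ℝ F x) (x + (0 : ℝ) • v) := by simpa using hF.hasFDerivAt
    exact hF'.comp_hasDerivAt (0 : ℝ) (hl v)
  have hE := fun v => (hcurve _ hG v).unique (hasDerivAt_mode_add_corrector n c (hcurve w hw v))
  simp only [zero_smul, add_zero] at hE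
  rw [hE 1, hE Complex.I]
  have := mode_divergence_algebra n c (w x) (w x ^ n) _ _ hdiv _ (fun a => rfl)
  simp only [Complex.ofReal_natCast, map_pow] at this
  rw [this]
  unfold curl dbar
  rw [pow_add]

theorem integral_fderiv_apply_eq_neg_integral_mul_div {ζ : ℂ → ℝ} (hζ : ContDiff ℝ 1 ζ)
    (hc : HasCompactSupport ζ) {V : ℂ → ℂ} (hV : ContDiff ℝ 1 V) :
    ∫ x, fderiv ℝ ζ x (V x) =
      -∫ x, ζ x * ((fderiv ℝ V x 1).re + (fderiv ℝ V x Complex.I).im) := by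
  have key : ∀ (ℓ : ℂ →L[ℝ] ℝ) (v : ℂ),
      Integrable (fun x => fderiv ℝ ζ x v * ℓ (V x)) ∧
      Integrable (fun x => ζ x * ℓ (fderiv ℝ V x v)) ∧
      ∫ x, fderiv ℝ ζ x v * ℓ (V x) = -∫ x, ζ x * ℓ (fderiv ℝ V x v) := by
    intro ℓ v
    have hg : ContDiff ℝ 1 fun x => ℓ (V x) := ℓ.contDiff.comp hV
    have hd : ∀ x, fderiv ℝ (fun x => ℓ (V x)) x v = ℓ (fderiv ℝ V x v) := fun x => by
      have : HasFDerivAt (fun x => ℓ (V x)) (ℓ.comp (fderiv ℝ V x)) x :=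
        ℓ.hasFDerivAt.comp x (hV.differentiable one_ne_zero x).hasFDerivAt
      rw [this.fderiv]
      rfl
    have i1 : Integrable fun x => fderiv ℝ ζ x v * ℓ (V x) :=
      (((hζ.continuous_fderiv one_ne_zero).clm_apply continuous_const).mul
        hg.continuous).integrable_of_hasCompactSupport (hc.fderiv_apply ℝ v).mul_right
    have i2 : Integrable fun x => ζ x * ℓ (fderiv ℝ V x v) :=
      (hζ.continuous.mul (ℓ.continuous.comp ((hV.continuous_fderiv one_ne_zero).clm_apply
        continuous_const))).integrable_of_hasCompactSupport hc.mul_right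
    refine ⟨i1, i2, ?_⟩
    have := integral_mul_fderiv_eq_neg_fderiv_mul_of_integrable (μ := (volume : Measure ℂ))
      (f := ζ) (g := fun x => ℓ (V x)) (v := v) i1 (by simpa only [hd] using i2)
      ((hζ.continuous.mul hg.continuous).integrable_of_hasCompactSupport hc.mul_right)
      (fun _ _ => hζ.differentiable one_ne_zero _) (fun _ _ => hg.differentiable one_ne_zero _)
    simp only [hd] at this
    rw [this, neg_neg]
  obtain ⟨a1, a2, a3⟩ := key Complex.reCLM 1
  obtain ⟨b1, b2, b3⟩ := key Complex.imCLM Complex.I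
  have e : ∀ x, fderiv ℝ ζ x (V x) =
      fderiv ℝ ζ x 1 * Complex.reCLM (V x) + fderiv ℝ ζ x Complex.I * Complex.imCLM (V x) := by
    intro x
    have : V x = (V x).re • (1 : ℂ) + (V x).im • Complex.I := by simp [Complex.re_add_im]
    conv_lhs => rw [this, map_add, map_smul, map_smul]
    simp [mul_comm]
  simp only [e, mul_add]
  rw [integral_add a1 b1, a3, b3, ← neg_add]
  congr 1
  exact (integral_add a2 b2).symm

/-! ### The weak limit of the defect times the curl -/

theorem exists_pos_closedBall_subset {Ω U : Set ℂ} (hΩ : IsOpen Ω) (hUc : IsCompact (closure U))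
    (hUΩ : closure U ⊆ Ω) : ∃ δ > 0, ∀ x ∈ U, Metric.closedBall x δ ⊆ Ω := by
  obtain ⟨δ, hδ, h⟩ := hUc.exists_cthickening_subset_open hΩ hUΩ
  exact ⟨δ, hδ, fun x hx =>
    (Metric.closedBall_subset_cthickening (subset_closure hx) δ).trans h⟩

/-- The bound on the product of the defect and the gradient, for a representative `M` of `m`, in
terms of the cubic increments of `m`. -/
theorem exists_ae_defect_mul_le : ∃ C : ℝ, 0 < C ∧ ∀ (Ω U : Set ℂ) (m M : ℂ → ℂ) (ε : ℕ → ℝ),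
    IsOpen Ω → IsOpen U → IsCompact (closure U) → closure U ⊆ Ω → Measurable M →
    (∀ x, ‖M x‖ ≤ 1) → (∀ᵐ x, x ∈ Ω → M x = m x ∧ ‖M x‖ = 1) →
    (∀ k, 0 < ε k) → Tendsto ε atTop (𝓝 0) →
    ∀ᶠ k in atTop, ∀ᵐ x ∂(volume.restrict U),
      (1 - ‖mollify (ε k) M x‖ ^ 2) * |curl (mollify (ε k) M) x| ≤
        C * cubicIncrement m (ε k) x ∧
      (1 - ‖mollify (ε k) M x‖ ^ 2) * ‖dbar (mollify (ε k) M) x‖ ≤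
        C * cubicIncrement m (ε k) x := by
  obtain ⟨C, hC, hb⟩ := exists_defect_mul_fderiv_le
  refine ⟨2 * C, by positivity,
    fun Ω U m M ε hΩ hU hUc hUΩ hM hM1 hMm hε hε0 => ?_⟩
  obtain ⟨δ, hδ, hball⟩ := exists_pos_closedBall_subset hΩ hUc hUΩ
  filter_upwards [hε0.eventually_lt_const hδ] with k hk
  filter_upwards [ae_restrict_mem hU.measurableSet, ae_restrict_of_ae hMm] with x hxU hx
  obtain ⟨hx1, hx2⟩ := hx (hUΩ (subset_closure hxU))
  have hsub : ∀ t ∈ Metric.ball (0 : ℂ) (ε k), x + t ∈ Ω := fun t ht => hball x hxU (by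
    rw [mem_ball_zero_iff] at ht
    rw [Metric.mem_closedBall, dist_eq_norm, add_sub_cancel_left]
    linarith)
  have hsub' : ∀ t ∈ Metric.ball (0 : ℂ) (ε k), x - t ∈ Ω := fun t ht => by
    rw [sub_eq_add_neg]
    exact hsub (-t) (by simpa using ht)
  have hae : ∀ᵐ t, t ∈ Metric.ball (0 : ℂ) (ε k) → ‖M (x - t)‖ = 1 := by
    filter_upwards [(Measure.measurePreserving_sub_left volume x).quasiMeasurePreserving.ae hMm]
      with t ht htb
    exact (ht (hsub' t htb)).2
  have hcub : cubicIncrement m (ε k) x = cubicIncrement M (ε k) x := by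
    unfold cubicIncrement
    congr 1
    refine setIntegral_congr_ae measurableSet_ball ?_
    filter_upwards [(measurePreserving_add_left volume x).quasiMeasurePreserving.ae hMm]
      with t ht htb
    rw [(ht (hsub t htb)).1, hx1]
  have h := hb M hM hM1 (ε k) (hε k) x hx2 hae
  have h1 := h 1
  have h2 := h Complex.I
  rw [norm_one, mul_one, ← hcub] at h1
  rw [Complex.norm_I, mul_one, ← hcub] at h2
  have hs : 0 ≤ 1 - ‖mollify (ε k) M x‖ ^ 2 := by
    have := mollify_norm_le_one (hε k) hM1 x
    nlinarith [norm_nonneg (mollify (ε k) M x)]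
  set A := fderiv ℝ (mollify (ε k) M) x 1 with hA
  set B := fderiv ℝ (mollify (ε k) M) x Complex.I with hB
  have e1 : |curl (mollify (ε k) M) x| ≤ ‖A‖ + ‖B‖ := by
    unfold curl
    exact (abs_sub _ _).trans (add_le_add (Complex.abs_im_le_norm _) (Complex.abs_re_le_norm _))
  have e2 : ‖dbar (mollify (ε k) M) x‖ ≤ ‖A‖ + ‖B‖ := by
    unfold dbar
    rw [norm_div, Complex.norm_ofNat]
    have := norm_add_le A (Complex.I * B)
    rw [norm_mul, Complex.norm_I, one_mul] at this
    have := norm_nonneg A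
    have := norm_nonneg B
    rw [← hA, ← hB]
    linarith
  constructor
  · have := mul_le_mul_of_nonneg_left e1 hs
    linarith
  · have := mul_le_mul_of_nonneg_left e2 hs
    linarith

/-- The members of an exhaustion of `Ω` by relatively compact open sets. -/
def exhaustion (Ω : Set ℂ) (n : ℕ) : Set ℂ :=
  Metric.ball 0 n ∩ {x | ENNReal.ofReal (1 / (n + 1)) < Metric.infEDist x Ωᶜ}

theorem exhaustion_isOpen (Ω : Set ℂ) (n : ℕ) : IsOpen (exhaustion Ω n) :=
  Metric.isOpen_ball.inter (isOpen_lt continuous_const Metric.continuous_infEDist)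

theorem exhaustion_isCompact_closure (Ω : Set ℂ) (n : ℕ) : IsCompact (closure (exhaustion Ω n)) :=
  (isCompact_closedBall (0 : ℂ) n).of_isClosed_subset isClosed_closure
    (closure_minimal (inter_subset_left.trans Metric.ball_subset_closedBall)
      Metric.isClosed_closedBall)

theorem exhaustion_closure_subset (Ω : Set ℂ) (n : ℕ) : closure (exhaustion Ω n) ⊆ Ω := by
  have h : closure (exhaustion Ω n) ⊆
      {x | ENNReal.ofReal (1 / (n + 1)) ≤ Metric.infEDist x Ωᶜ} :=
    closure_minimal (fun x hx => by
      have h := hx.2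
      rw [Set.mem_ofPred_eq] at h ⊢
      exact h.le)
      (isClosed_le continuous_const Metric.continuous_infEDist)
  intro x hx
  by_contra hxΩ
  have h1 := h hx
  rw [Set.mem_ofPred_eq, Metric.infEDist_zero_of_mem (show x ∈ Ωᶜ from hxΩ), nonpos_iff_eq_zero,
    ENNReal.ofReal_eq_zero] at h1
  have : (0 : ℝ) < 1 / (n + 1) := by positivity
  linarith

theorem exhaustion_mono (Ω : Set ℂ) : Monotone (exhaustion Ω) := by
  intro n k hnk x hx
  refine ⟨Metric.ball_subset_ball (by exact_mod_cast hnk) hx.1, ?_⟩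
  have h := hx.2
  rw [Set.mem_ofPred_eq] at h ⊢
  exact (ENNReal.ofReal_le_ofReal (by gcongr)).trans_lt h

theorem exists_subset_exhaustion {Ω K : Set ℂ} (hΩ : IsOpen Ω) (hK : IsCompact K) (hKΩ : K ⊆ Ω) :
    ∃ n, K ⊆ exhaustion Ω n := by
  refine hK.elim_directed_cover _ (exhaustion_isOpen Ω) (fun x hx => ?_)
    (exhaustion_mono Ω).directed_le
  have hpos : 0 < Metric.infEDist x Ωᶜ := by
    rw [Metric.infEDist_pos_iff_notMem_closure, hΩ.isClosed_compl.closure_eq]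
    exact fun h => h (hKΩ hx)
  have h1 : Tendsto (fun n : ℕ => ENNReal.ofReal (1 / ((n : ℝ) + 1))) atTop (𝓝 0) := by
    simpa using ENNReal.tendsto_ofReal tendsto_one_div_add_atTop_nhds_zero_nat
  obtain ⟨n, hn1, hn2⟩ := ((h1.eventually_lt_const hpos).and
    (tendsto_natCast_atTop_atTop.eventually_gt_atTop ‖x‖)).exists
  exact mem_iUnion.mpr ⟨n, mem_ball_zero_iff.mpr hn2, hn1⟩

/-- Local weak limits fit together, as they are unique almost everywhere. -/
theorem exists_global_weak_limit {Ω : Set ℂ} (hΩ : IsOpen Ω) {l : Filter ℕ} [l.NeBot]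
    {q : ℕ → ℂ → ℝ} {F : ℂ → ℝ}
    (hloc : ∀ U, IsOpen U → IsCompact (closure U) → closure U ⊆ Ω → ∃ g : ℂ → ℝ,
      IntegrableOn g U ∧ (∀ᵐ x ∂(volume.restrict U), |g x| ≤ F x) ∧
      ∀ A, MeasurableSet A → Tendsto (fun k => ∫ x in A, q k x ∂(volume.restrict U)) l
        (𝓝 (∫ x in A, g x ∂(volume.restrict U)))) :
    ∃ g : ℂ → ℝ, ∀ U, IsOpen U → IsCompact (closure U) → closure U ⊆ Ω →
      IntegrableOn g U ∧ (∀ᵐ x ∂(volume.restrict U), |g x| ≤ F x) ∧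
      ∀ A, MeasurableSet A → Tendsto (fun k => ∫ x in A, q k x ∂(volume.restrict U)) l
        (𝓝 (∫ x in A, g x ∂(volume.restrict U))) := by
  choose G hGi hGF hGlim using fun n => hloc (exhaustion Ω n) (exhaustion_isOpen Ω n)
    (exhaustion_isCompact_closure Ω n) (exhaustion_closure_subset Ω n)
  have hmeas := fun n => (exhaustion_isOpen Ω n).measurableSet
  have huniq : ∀ n N, n ≤ N → G n =ᵐ[volume.restrict (exhaustion Ω n)] G N := by
    intro n N hnN
    have hsub := exhaustion_mono Ω hnN
    refine Integrable.ae_eq_of_forall_setIntegral_eq _ _ (hGi n) ((hGi N).mono_set hsub)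
      fun A hA _ => ?_
    have e : (volume.restrict (exhaustion Ω N)).restrict (A ∩ exhaustion Ω n) =
        (volume.restrict (exhaustion Ω n)).restrict A := by
      rw [Measure.restrict_restrict (hA.inter (hmeas n)), Measure.restrict_restrict hA,
        inter_assoc, inter_eq_left.mpr hsub]
    have h2 := hGlim N _ (hA.inter (hmeas n))
    simp only [e] at h2
    exact tendsto_nhds_unique (hGlim n A hA) h2
  classical
  let g : ℂ → ℝ := fun x =>
    if h : ∃ n, x ∈ exhaustion Ω n then G (Nat.find h) x else 0
  have hg : ∀ N, g =ᵐ[volume.restrict (exhaustion Ω N)] G N := by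
    intro N
    have : ∀ᵐ x, ∀ n ≤ N, x ∈ exhaustion Ω n → G n x = G N x := by
      rw [ae_all_iff]
      intro n
      by_cases hn : n ≤ N
      · filter_upwards [(ae_restrict_iff' (hmeas n)).mp (huniq n N hn)] with x hx _ hxn
        exact hx hxn
      · exact Eventually.of_forall fun x h => absurd h hn
    filter_upwards [ae_restrict_of_ae this, ae_restrict_mem (hmeas N)] with x hx hxN
    have hex : ∃ n, x ∈ exhaustion Ω n := ⟨N, hxN⟩
    simp only [g, dif_pos hex]
    exact hx _ (Nat.find_min' hex hxN) (Nat.find_spec hex)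
  refine ⟨g, fun U hU hUc hUΩ => ?_⟩
  obtain ⟨N, hN⟩ := exists_subset_exhaustion hΩ hUc hUΩ
  have hUN : U ⊆ exhaustion Ω N := subset_closure.trans hN
  have hgU : g =ᵐ[volume.restrict U] G N := ae_restrict_of_ae_restrict_of_subset hUN (hg N)
  refine ⟨((hGi N).mono_set hUN).congr hgU.symm, ?_, fun A hA => ?_⟩
  · filter_upwards [hgU, ae_restrict_of_ae_restrict_of_subset hUN (hGF N)] with x h1 h2
    rwa [h1]
  · have e : (volume.restrict (exhaustion Ω N)).restrict (A ∩ U) =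
        (volume.restrict U).restrict A := by
      rw [Measure.restrict_restrict (hA.inter hU.measurableSet), Measure.restrict_restrict hA,
        inter_assoc, inter_eq_left.mpr hUN]
    have h2 := hGlim N _ (hA.inter hU.measurableSet)
    simp only [e] at h2
    rwa [integral_congr_ae (ae_restrict_of_ae hgU)]

/-! ### Passing to the limit in a single mode -/

section ModeLimit

theorem isFiniteMeasure_restrict_of_isCompact_closure {U : Set ℂ} (hUc : IsCompact (closure U)) :
    IsFiniteMeasure (volume.restrict U) :=
  isFiniteMeasure_restrict.mpr
    ((measure_mono subset_closure).trans_lt hUc.measure_lt_top).ne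

/-- On bounded sets, weak convergence in `L^p` may be tested with bounded functions, whatever
`p` is. -/
theorem TendstoWeaklyLpLoc.tendsto_integral_mul {Ω : Set ℂ} {p : ℝ≥0∞} (hp1 : 1 ≤ p)
    {u : ℕ → ℂ → ℝ} {v : ℂ → ℝ} (h : TendstoWeaklyLpLoc Ω p u v) (C : ℝ) {U : Set ℂ}
    (hU : IsOpen U) (hUc : IsCompact (closure U)) (hUΩ : closure U ⊆ Ω) :
    (∀ᶠ k in atTop, Integrable (fun x => C * u k x) (volume.restrict U)) ∧
      Integrable (fun x => C * v x) (volume.restrict U) ∧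
      ∀ g : ℂ → ℝ, Measurable g → (∃ B, ∀ x, |g x| ≤ B) →
        Tendsto (fun k => ∫ x in U, C * u k x * g x) atTop (𝓝 (∫ x in U, C * v x * g x)) := by
  have := isFiniteMeasure_restrict_of_isCompact_closure hUc
  obtain ⟨h1, h2, h3⟩ := h U hU hUc hUΩ
  refine ⟨h1.mono fun k hk => (hk.integrable hp1).const_mul C, (h2.integrable hp1).const_mul C,
    fun g hg ⟨B, hB⟩ => ?_⟩
  have := (h3 g (MemLp.of_bound hg.aestronglyMeasurable B (Eventually.of_forall hB))).const_mul C
  simpa only [mul_assoc, integral_const_mul] using this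

variable {Ω : Set ℂ} {m M : ℂ → ℂ} {ε : ℕ → ℝ} {p : ℝ≥0∞} {P : ℂ → ℝ}

theorem mollify_measurable {ε : ℝ} (hε : 0 < ε) (hM : Measurable M) (hM1 : ∀ x, ‖M x‖ ≤ 1) :
    Measurable (mollify ε M) :=
  (mollify_contDiff hε hM hM1).continuous.measurable

theorem defect_nonneg {ε : ℝ} (hε : 0 < ε) (hM1 : ∀ x, ‖M x‖ ≤ 1) (x : ℂ) :
    0 ≤ 1 - ‖mollify ε M x‖ ^ 2 := by
  have := mollify_norm_le_one hε hM1 x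
  nlinarith [norm_nonneg (mollify ε M x)]

theorem mollify_curl_continuous {ε : ℝ} (hε : 0 < ε) (hM : Measurable M) (hM1 : ∀ x, ‖M x‖ ≤ 1) :
    Continuous (curl (mollify ε M)) := by
  have h := fun v : ℂ => ((mollify_contDiff hε hM hM1).continuous_fderiv (by simp)).clm_apply
    (continuous_const (y := v))
  exact (Complex.continuous_im.comp (h 1)).sub (Complex.continuous_re.comp (h Complex.I))

theorem mollify_dbar_continuous {ε : ℝ} (hε : 0 < ε) (hM : Measurable M) (hM1 : ∀ x, ‖M x‖ ≤ 1) :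
    Continuous (dbar (mollify ε M)) := by
  have h := fun v : ℂ => ((mollify_contDiff hε hM hM1).continuous_fderiv (by simp)).clm_apply
    (continuous_const (y := v))
  exact ((h 1).add (continuous_const.mul (h Complex.I))).div_const 2

/-- `lam` is the weak limit, on every relatively compact open subset of `Ω`, of the products of the
defect `1 - |w|²` and the curl of the mollifications `w = M * ρ_ε`, and `|lam| ≤ F` almost
everywhere. The limit is taken along the hyperfilter on the indices, which spares the choice of a
subsequence, and is tested against indicator functions. -/
def IsDefectCurlLimit (Ω : Set ℂ) (M : ℂ → ℂ) (ε : ℕ → ℝ) (F lam : ℂ → ℝ) : Prop :=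
  ∀ U, IsOpen U → IsCompact (closure U) → closure U ⊆ Ω →
    IntegrableOn lam U ∧ (∀ᵐ x ∂(volume.restrict U), |lam x| ≤ F x) ∧
    ∀ A, MeasurableSet A → Tendsto (fun k => ∫ x in A,
        (1 - ‖mollify (ε k) M x‖ ^ 2) * curl (mollify (ε k) M) x ∂(volume.restrict U))
      (hyperfilter ℕ) (𝓝 (∫ x in A, lam x ∂(volume.restrict U)))

theorem exists_isDefectCurlLimit (hΩ : IsOpen Ω) (hp1 : 1 ≤ p) (hM : Measurable M)
    (hM1 : ∀ x, ‖M x‖ ≤ 1) (hMm : ∀ᵐ x, x ∈ Ω → M x = m x ∧ ‖M x‖ = 1)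
    (hε : ∀ k, 0 < ε k) (hε0 : Tendsto ε atTop (𝓝 0))
    (hP : TendstoWeaklyLpLoc Ω p (fun k => cubicIncrement m (ε k)) P) :
    ∃ C, ∃ lam : ℂ → ℝ, IsDefectCurlLimit Ω M ε (fun x => C * P x) lam := by
  obtain ⟨C, -, hb⟩ := exists_ae_defect_mul_le
  refine ⟨C, exists_global_weak_limit hΩ fun U hU hUc hUΩ => ?_⟩
  have := isFiniteMeasure_restrict_of_isCompact_closure hUc
  obtain ⟨h1, h2, h3⟩ := hP.tendsto_integral_mul hp1 C hU hUc hUΩ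
  have hdom := hb Ω U m M ε hΩ hU hUc hUΩ hM hM1 hMm hε hε0
  have hq : ∀ᶠ k in atTop, ∀ᵐ x ∂(volume.restrict U),
      |(1 - ‖mollify (ε k) M x‖ ^ 2) * curl (mollify (ε k) M) x| ≤
        C * cubicIncrement m (ε k) x := by
    filter_upwards [hdom] with k hk
    filter_upwards [hk] with x hx
    rw [abs_mul, abs_of_nonneg (defect_nonneg (hε k) hM1 x)]
    exact hx.1
  have hqi : ∀ᶠ k in atTop, Integrable
      (fun x => (1 - ‖mollify (ε k) M x‖ ^ 2) * curl (mollify (ε k) M) x)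
      (volume.restrict U) := by
    filter_upwards [h1, hq] with k hk hk'
    refine hk.mono' ?_ hk'
    exact ((measurable_const.sub ((mollify_measurable (hε k) hM hM1).norm.pow_const 2)).mul
      (mollify_curl_continuous (hε k) hM hM1).measurable).aestronglyMeasurable
  have hset : ∀ A, MeasurableSet A →
      Tendsto (fun k => ∫ x in A, C * cubicIncrement m (ε k) x ∂(volume.restrict U))
        (hyperfilter ℕ) (𝓝 (∫ x in A, C * P x ∂(volume.restrict U))) := by
    intro A hA
    have := (h3 (A.indicator fun _ => 1) (measurable_const.indicator hA)
      ⟨1, fun x => by by_cases hx : x ∈ A <;> simp [hx]⟩).mono_left Nat.hyperfilter_le_atTop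
    have e : ∀ u : ℂ → ℝ, ∫ x in U, u x * A.indicator (fun _ => (1 : ℝ)) x =
        ∫ x in A, u x ∂(volume.restrict U) := fun u => by
      rw [← integral_indicator hA]
      congr 1
      ext x
      by_cases hx : x ∈ A <;> simp [hx]
    simpa only [e] using this
  obtain ⟨g, -, hg⟩ := exists_weak_limit_of_dominated (hyperfilter ℕ)
    (Nat.hyperfilter_le_atTop hqi) (Nat.hyperfilter_le_atTop h1) h2
    (Nat.hyperfilter_le_atTop hq) hset
  exact ⟨g, hg⟩

theorem modeCorrector_eq_zero (n : ℕ) (c : ℂ) {z : ℂ} (hz : ‖z‖ = 1) :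
    modeCorrector n c z = 0 := by
  have : z * conj z = 1 := by rw [Complex.mul_conj, Complex.normSq_eq_norm_sq, hz]; simp
  simp [modeCorrector, this]

/-- The divergence of the entropies of the modes `k = n + 2`, by passing to the limit in the
identity for the corrected entropies of the mollifications. -/
theorem integral_fderiv_modeEntropy_add_two (hΩ : IsOpen Ω) (hp1 : 1 ≤ p) (hM : Measurable M)
    (hM1 : ∀ x, ‖M x‖ ≤ 1) (hMm : ∀ᵐ x, x ∈ Ω → M x = m x ∧ ‖M x‖ = 1)
    (hdiv : ∀ ζ : ℂ → ℝ, ContDiff ℝ (⊤ : ℕ∞) ζ → HasCompactSupport ζ → tsupport ζ ⊆ Ω →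
      ∫ x in Ω, fderiv ℝ ζ x (M x) = 0)
    (hε : ∀ k, 0 < ε k) (hε0 : Tendsto ε atTop (𝓝 0))
    (hP : TendstoWeaklyLpLoc Ω p (fun k => cubicIncrement m (ε k)) P)
    {F lam : ℂ → ℝ} (hlam : IsDefectCurlLimit Ω M ε F lam) (n : ℕ) (c : ℂ)
    {ζ : ℂ → ℝ} (hζ : ContDiff ℝ (⊤ : ℕ∞) ζ) (hζc : HasCompactSupport ζ) (hζΩ : tsupport ζ ⊆ Ω) :
    ∫ x in Ω, fderiv ℝ ζ x (modeEntropy (n + 2) c (M x)) =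
      -∫ x in Ω, (n + 1) * (n + 2) * (n + 3) / 2 * (Complex.I * c * M x ^ (n + 2)).re *
        lam x * ζ x := by
  obtain ⟨U, hU, hζU, hUΩ, hUc⟩ := exists_open_between_and_isCompact_closure hζc hΩ hζΩ
  have hfin := isFiniteMeasure_restrict_of_isCompact_closure hUc
  obtain ⟨δ, hδ, hball⟩ := exists_pos_closedBall_subset hΩ hUc hUΩ
  obtain ⟨C, -, hb⟩ := exists_ae_defect_mul_le
  obtain ⟨h1, h2, h3⟩ := hP.tendsto_integral_mul hp1 ((1 + ‖c‖) * C) hU hUc hUΩ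
  have hdom := hb Ω U m M ε hΩ hU hUc hUΩ hM hM1 hMm hε hε0
  obtain ⟨hlami, -, hlamlim⟩ := hlam U hU hUc hUΩ
  set w : ℕ → ℂ → ℂ := fun k => mollify (ε k) M with hw
  have hwc : ∀ k, ContDiff ℝ (⊤ : ℕ∞) (w k) := fun k => mollify_contDiff (hε k) hM hM1
  have hwm : ∀ k, Measurable (w k) := fun k => (hwc k).continuous.measurable
  have hw1 : ∀ k x, ‖w k x‖ ≤ 1 := fun k x => mollify_norm_le_one (hε k) hM1 x
  have hwlim : ∀ᵐ x, Tendsto (fun k => w k x) atTop (𝓝 (M x)) := ae_tendsto_mollify hM hM1 hε hε0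
  have hs0 : ∀ k x, 0 ≤ 1 - ‖w k x‖ ^ 2 := fun k x => defect_nonneg (hε k) hM1 x
  have hs1 : ∀ k x, 1 - ‖w k x‖ ^ 2 ≤ 1 := fun k x => by
    have := sq_nonneg ‖w k x‖
    linarith
  have hsm : ∀ k, Measurable fun x => 1 - ‖w k x‖ ^ 2 := fun k =>
    measurable_const.sub ((hwm k).norm.pow_const 2)
  set G : ℂ → ℂ := fun z => modeEntropy (n + 2) c z + modeCorrector n c z with hG
  have hGc : ContDiff ℝ (⊤ : ℕ∞) G := (modeEntropy_contDiff _ c).add (modeCorrector_contDiff n c)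
  have hζm : Measurable ζ := hζ.continuous.measurable
  obtain ⟨Z, hZ⟩ := hζc.exists_bound_of_continuous hζ.continuous
  have hZ0 : 0 ≤ Z := (norm_nonneg _).trans (hZ 0)
  -- Quantities multiplied by `ζ` only matter on `U`.
  have hζ0 : ∀ x, x ∉ U → ζ x = 0 := fun x hx =>
    image_eq_zero_of_notMem_tsupport fun h => hx (hζU h)
  have hdζ0 : ∀ x, x ∉ Ω → fderiv ℝ ζ x = 0 := fun x hx =>
    image_eq_zero_of_notMem_tsupport fun h => hx (hζΩ (tsupport_fderiv_subset ℝ h))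
  set a : ℝ := (n + 1) * (n + 2) * (n + 3) / 2 with ha
  -- The limit of the pairing with `∇ζ`.
  have hleft : Tendsto (fun k => ∫ x, fderiv ℝ ζ x (G (w k x))) atTop
      (𝓝 (∫ x in Ω, fderiv ℝ ζ x (modeEntropy (n + 2) c (M x)))) := by
    rw [setIntegral_eq_integral_of_forall_compl_eq_zero fun x hx => by simp [hdζ0 x hx]]
    obtain ⟨D, hD⟩ := (isCompact_closedBall (0 : ℂ) 1).exists_bound_of_continuousOn
      hGc.continuous.continuousOn
    have hdc := hζ.continuous_fderiv (by simp)
    refine tendsto_integral_of_dominated_convergence (fun x => ‖fderiv ℝ ζ x‖ * D)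
      (fun k => (hdc.clm_apply (hGc.continuous.comp (hwc k).continuous)).aestronglyMeasurable)
      ((hdc.norm.integrable_of_hasCompactSupport (hζc.fderiv ℝ).norm).mul_const D)
      (fun k => Eventually.of_forall fun x => (ContinuousLinearMap.le_opNorm _ _).trans
        (mul_le_mul_of_nonneg_left (hD _ (mem_closedBall_zero_iff.mpr (hw1 k x)))
          (norm_nonneg _))) ?_
    filter_upwards [hwlim, hMm] with x hx hx'
    by_cases hxΩ : x ∈ Ω
    · have e : G (M x) = modeEntropy (n + 2) c (M x) := by
        rw [hG]
        simp only
        rw [modeCorrector_eq_zero n c (hx' hxΩ).2, add_zero]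
      rw [← e]
      exact ((fderiv ℝ ζ x).continuous.tendsto _).comp ((hGc.continuous.tendsto _).comp hx)
    · simp [hdζ0 x hxΩ]
  -- The two dominated sequences, and the bounded functions they are tested with.
  set q₁ : ℕ → ℂ → ℝ := fun k x => (1 - ‖w k x‖ ^ 2) * curl (w k) x with hq₁
  set q₂ : ℕ → ℂ → ℝ := fun k x => (1 - ‖w k x‖ ^ 2) * (c * w k x ^ n * dbar (w k) x).re with hq₂
  set g : ℂ → ℝ := fun x => ζ x * (Complex.I * c * M x ^ (n + 2)).re with hg
  set b₁ : ℕ → ℂ → ℝ :=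
    fun k x => ζ x * (Complex.I * c * (w k x ^ (n + 2) - M x ^ (n + 2))).re with hb₁
  set b₂ : ℕ → ℂ → ℝ := fun k x => ζ x * (1 - ‖w k x‖ ^ 2) with hb₂
  have hq₁m : ∀ k, Measurable (q₁ k) := fun k =>
    (hsm k).mul (mollify_curl_continuous (hε k) hM hM1).measurable
  have hq₂m : ∀ k, Measurable (q₂ k) := fun k =>
    (hsm k).mul (Complex.measurable_re.comp ((((hwm k).pow_const n).const_mul c).mul
      (mollify_dbar_continuous (hε k) hM hM1).measurable))
  have hgm : Measurable g := hζm.mul (Complex.measurable_re.comp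
    ((hM.pow_const (n + 2)).const_mul (Complex.I * c)))
  have hb₁m : ∀ k, Measurable (b₁ k) := fun k => hζm.mul (Complex.measurable_re.comp
    ((((hwm k).pow_const (n + 2)).sub (hM.pow_const (n + 2))).const_mul (Complex.I * c)))
  have hb₂m : ∀ k, Measurable (b₂ k) := fun k => hζm.mul (hsm k)
  have hpow : ∀ (j : ℕ) {z : ℂ}, ‖z‖ ≤ 1 → ‖z ^ j‖ ≤ 1 := fun j z hz => by
    rw [norm_pow]
    exact pow_le_one₀ (norm_nonneg _) hz
  have hre : ∀ {z : ℂ} {B : ℝ}, ‖z‖ ≤ B → ∀ x, |ζ x * (Complex.I * c * z).re| ≤ Z * (‖c‖ * B) := by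
    intro z B hz x
    rw [abs_mul]
    refine mul_le_mul (hZ x) ((Complex.abs_re_le_norm _).trans ?_) (abs_nonneg _) hZ0
    rw [norm_mul, norm_mul, Complex.norm_I, one_mul]
    gcongr
  have hgB : ∀ x, |g x| ≤ Z * (‖c‖ * 1) := fun x => hre (hpow _ (hM1 x)) x
  have hb₁B : ∀ k x, |b₁ k x| ≤ Z * (‖c‖ * 2) := fun k x => by
    refine hre ((norm_sub_le _ _).trans ?_) x
    have := hpow (n + 2) (hM1 x)
    have := hpow (n + 2) (hw1 k x)
    linarith
  have hb₂B : ∀ k x, |b₂ k x| ≤ Z := fun k x => by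
    rw [hb₂, abs_mul, abs_of_nonneg (hs0 k x)]
    exact (mul_le_of_le_one_right (abs_nonneg _) (hs1 k x)).trans (hZ x)
  have hdom₁ : ∀ᶠ k in atTop, ∀ᵐ x ∂(volume.restrict U),
      |q₁ k x| ≤ (1 + ‖c‖) * C * cubicIncrement m (ε k) x := by
    filter_upwards [hdom] with k hk
    filter_upwards [hk] with x hx
    rw [hq₁, abs_mul, abs_of_nonneg (hs0 k x)]
    have h0 := (mul_nonneg (hs0 k x) (abs_nonneg _)).trans hx.1
    have := mul_nonneg (norm_nonneg c) h0
    linarith [hx.1]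
  have hdom₂ : ∀ᶠ k in atTop, ∀ᵐ x ∂(volume.restrict U),
      |q₂ k x| ≤ (1 + ‖c‖) * C * cubicIncrement m (ε k) x := by
    filter_upwards [hdom] with k hk
    filter_upwards [hk] with x hx
    rw [hq₂, abs_mul, abs_of_nonneg (hs0 k x)]
    have h0 := (mul_nonneg (hs0 k x) (abs_nonneg _)).trans hx.1
    have e : |(c * w k x ^ n * dbar (w k) x).re| ≤ ‖c‖ * ‖dbar (w k) x‖ := by
      refine (Complex.abs_re_le_norm _).trans ?_
      rw [norm_mul, norm_mul]
      gcongr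
      exact mul_le_of_le_one_right (norm_nonneg c) (hpow n (hw1 k x))
    have e1 := mul_le_mul_of_nonneg_left e (hs0 k x)
    have e2 := mul_le_mul_of_nonneg_left hx.2 (norm_nonneg c)
    linarith
  have hi₁ : ∀ᶠ k in atTop, Integrable (q₁ k) (volume.restrict U) := by
    filter_upwards [h1, hdom₁] with k hk hk'
    exact hk.mono' (hq₁m k).aestronglyMeasurable hk'
  have hi₂ : ∀ᶠ k in atTop, Integrable (q₂ k) (volume.restrict U) := by
    filter_upwards [h1, hdom₂] with k hk hk'
    exact hk.mono' (hq₂m k).aestronglyMeasurable hk'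
  have hid : ∀ᶠ k in atTop, ∫ x, fderiv ℝ ζ x (G (w k x)) =
      -(a * (((∫ x in U, q₁ k x * g x) + ∫ x in U, q₁ k x * b₁ k x) +
        (n + 3) * ∫ x in U, q₂ k x * b₂ k x)) := by
    filter_upwards [hε0.eventually_lt_const hδ, hi₁, hi₂] with k hk hk1 hk2
    have hj1 : Integrable (fun x => q₁ k x * g x) (volume.restrict U) :=
      hk1.mul_bdd hgm.aestronglyMeasurable (Eventually.of_forall hgB)
    have hj2 : Integrable (fun x => q₁ k x * b₁ k x) (volume.restrict U) :=
      hk1.mul_bdd (hb₁m k).aestronglyMeasurable (Eventually.of_forall (hb₁B k))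
    have hj3 : Integrable (fun x => q₂ k x * b₂ k x) (volume.restrict U) :=
      hk2.mul_bdd (hb₂m k).aestronglyMeasurable (Eventually.of_forall (hb₂B k))
    rw [integral_fderiv_apply_eq_neg_integral_mul_div (V := fun x => G (w k x))
      (hζ.of_le (by simp)) hζc ((hGc.comp (hwc k)).of_le (by simp)),
      ← setIntegral_eq_integral_of_forall_compl_eq_zero (s := U) fun x hx => by simp [hζ0 x hx]]
    congr 1
    rw [← integral_add hj1 hj2, ← integral_const_mul,
      ← integral_add (f := fun x => q₁ k x * g x + q₁ k x * b₁ k x) (hj1.add hj2)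
        (hj3.const_mul _), ← integral_const_mul]
    refine setIntegral_congr_fun hU.measurableSet fun x hx => ?_
    have hd := mollify_div_eq_zero (hε k) hM hM1 hdiv
      ((Metric.closedBall_subset_closedBall hk.le).trans (hball x hx))
    have := div_mode_add_corrector n c ((hwc k).differentiable (by simp) x) hd
    simp only [hG, hq₁, hq₂, hg, hb₁, hb₂]
    rw [this]
    simp only [mul_sub, Complex.sub_re, ha]
    ring
  have hL1 : Tendsto (fun k => ∫ x in U, q₁ k x * g x) (hyperfilter ℕ)
      (𝓝 (∫ x in U, lam x * g x)) := by
    have h3' := h3 (fun _ => 1) measurable_const ⟨1, fun _ => by simp⟩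
    refine tendsto_integral_mul_of_tendsto_setIntegral
      (C := (∫ x in U, (1 + ‖c‖) * C * P x * 1) + 1)
      (Nat.hyperfilter_le_atTop hi₁) (Nat.hyperfilter_le_atTop ?_) hlami hlamlim hgm hgB
    filter_upwards [h1, hdom₁, hi₁, h3'.eventually_le_const (lt_add_one _)] with k k1 k2 k3 k4
    refine le_trans (integral_mono_ae k3.abs k1 k2) (le_trans (le_of_eq ?_) k4)
    simp
  have hL2 : Tendsto (fun k => ∫ x in U, q₁ k x * b₁ k x) atTop (𝓝 0) := by
    refine tendsto_integral_mul_zero_of_dominated h1 h2 hdom₁ h3 hb₁m hb₁B ?_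
    filter_upwards [ae_restrict_of_ae hwlim] with x hx
    have e1 : Tendsto (fun k => w k x ^ (n + 2) - M x ^ (n + 2)) atTop (𝓝 0) := by
      simpa using (hx.pow (n + 2)).sub_const (M x ^ (n + 2))
    have e2 := ((Complex.continuous_re.tendsto _).comp
      (e1.const_mul (Complex.I * c))).const_mul (ζ x)
    rwa [mul_zero, Complex.zero_re, mul_zero] at e2
  have hL3 : Tendsto (fun k => ∫ x in U, q₂ k x * b₂ k x) atTop (𝓝 0) := by
    refine tendsto_integral_mul_zero_of_dominated h1 h2 hdom₂ h3 hb₂m hb₂B ?_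
    filter_upwards [ae_restrict_of_ae hwlim, ae_restrict_of_ae hMm,
      ae_restrict_mem hU.measurableSet] with x hx hx' hxU
    have e := ((hx.norm.pow 2).const_sub 1).const_mul (ζ x)
    rw [(hx' (hUΩ (subset_closure hxU))).2] at e
    simpa using e
  have hlim := ((((hL1.add (hL2.mono_left Nat.hyperfilter_le_atTop)).add
    ((hL3.mono_left Nat.hyperfilter_le_atTop).const_mul ((n : ℝ) + 3))).const_mul a).neg).congr'
    (Nat.hyperfilter_le_atTop (hid.mono fun k hk => hk.symm))
  rw [tendsto_nhds_unique (hleft.mono_left Nat.hyperfilter_le_atTop) hlim]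
  rw [add_zero, mul_zero, add_zero, ← integral_const_mul,
    setIntegral_eq_integral_of_forall_compl_eq_zero (s := U) fun x hx => by simp [hg, hζ0 x hx],
    setIntegral_eq_integral_of_forall_compl_eq_zero (s := Ω) fun x hx => by
      rw [hζ0 x fun h => hx (hUΩ (subset_closure h)), mul_zero]]
  congr 2
  ext x
  simp only [hg]
  ring

end ModeLimit

/-! ### Fourier series of functions of class `C⁴` on the circle -/

section FourierSeries

theorem fact_two_pi_pos : Fact (0 < 2 * π) := ⟨Real.two_pi_pos⟩

attribute [local instance] fact_two_pi_pos

/-- The function on `ℝ / 2πℤ` induced by a continuous periodic function. -/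
def periodicLift (h : ℝ → ℂ) (hc : Continuous h) (hp : Function.Periodic h (2 * π)) :
    C(AddCircle (2 * π), ℂ) :=
  ⟨hp.lift, continuous_coinduced_dom.mpr hc⟩

theorem fourierCoeff_periodicLift {h : ℝ → ℂ} (hc : Continuous h)
    (hp : Function.Periodic h (2 * π)) (k : ℤ) :
    fourierCoeff (periodicLift h hc hp) k =
      (1 / (2 * π) : ℝ) • ∫ t in (0 : ℝ)..(2 * π), Complex.exp (-(k * t * Complex.I)) * h t := by
  rw [fourierCoeff_eq_intervalIntegral _ _ 0, zero_add]
  congr 1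
  apply intervalIntegral.integral_congr
  intro t _
  have hpi : (π : ℂ) ≠ 0 := by exact_mod_cast Real.pi_ne_zero
  have h1 : periodicLift h hc hp (t : AddCircle (2 * π)) = h t := hp.lift_coe t
  simp only [smul_eq_mul, h1, fourier_coe_apply]
  congr 2
  push_cast
  field_simp

theorem fourierCoeff_periodicLift_deriv {h h' : ℝ → ℂ} (hd : ∀ t, HasDerivAt h (h' t) t)
    (hc : Continuous h) (hp : Function.Periodic h (2 * π)) (hc' : Continuous h')
    (hp' : Function.Periodic h' (2 * π)) (k : ℤ) :
    fourierCoeff (periodicLift h' hc' hp') k =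
      Complex.I * k * fourierCoeff (periodicLift h hc hp) k := by
  rw [fourierCoeff_periodicLift, fourierCoeff_periodicLift]
  have he : ∀ t : ℝ, HasDerivAt (fun t : ℝ => Complex.exp (-(k * t * Complex.I)))
      (Complex.exp (-(k * t * Complex.I)) * -(k * Complex.I)) t := by
    intro t
    have h0 : HasDerivAt (fun t : ℝ => -((k : ℂ) * t * Complex.I)) (-(k * Complex.I)) t := by
      have := (((hasDerivAt_id t).ofReal_comp.const_mul (k : ℂ)).mul_const Complex.I).neg
      rw [Complex.ofReal_one, mul_one] at this
      exact this
    exact h0.cexp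
  have hce : Continuous fun t : ℝ => Complex.exp (-(k * t * Complex.I)) := by fun_prop
  have hparts := intervalIntegral.integral_mul_deriv_eq_deriv_mul (a := 0) (b := 2 * π)
    (fun t _ => he t) (fun t _ => hd t)
    ((hce.mul continuous_const).intervalIntegrable _ _) (hc'.intervalIntegrable _ _)
  have hb : Complex.exp (-(k * ((2 * π : ℝ) : ℂ) * Complex.I)) * h (2 * π) -
      Complex.exp (-(k * ((0 : ℝ) : ℂ) * Complex.I)) * h 0 = 0 := by
    have e1 : Complex.exp (-(k * ((2 * π : ℝ) : ℂ) * Complex.I)) = 1 := by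
      rw [Complex.exp_eq_one_iff]
      exact ⟨-k, by push_cast; ring⟩
    have e2 : h (2 * π) = h 0 := by simpa using hp 0
    rw [e1, e2]
    simp
  rw [hparts, hb, zero_sub, ← intervalIntegral.integral_neg]
  simp only [Complex.real_smul]
  rw [mul_left_comm, ← intervalIntegral.integral_const_mul (Complex.I * k)]
  congr 1
  refine intervalIntegral.integral_congr fun t _ => ?_
  ring

theorem summable_sq_norm_fourierCoeff (H : C(AddCircle (2 * π), ℂ)) :
    Summable fun k => ‖fourierCoeff H k‖ ^ 2 := by
  have := (hasSum_sq_fourierCoeff (T := 2 * π)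
    (ContinuousMap.toLp (E := ℂ) 2 AddCircle.haarAddCircle ℂ H)).summable
  simpa only [fourierCoeff_toLp] using this

variable {ψ : Circle → ℂ}

theorem IsC4.periodic_iteratedDeriv (ψ : Circle → ℂ) (j : ℕ) :
    Function.Periodic (iteratedDeriv j fun t : ℝ => ψ (Circle.exp t)) (2 * π) := by
  intro t
  have := congrFun (iteratedDeriv_comp_add_const j (fun t : ℝ => ψ (Circle.exp t)) (2 * π)) t
  simp only [Circle.exp_two_pi, Circle.exp_add, mul_one] at this
  exact this.symm

theorem IsC4.continuous_iteratedDeriv (hψ : IsC4 ψ) {j : ℕ} (hj : j ≤ 4) :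
    Continuous (iteratedDeriv j fun t : ℝ => ψ (Circle.exp t)) :=
  ContDiff.continuous_iteratedDeriv j hψ (by exact_mod_cast hj)

/-- The Fourier coefficients of the derivatives. -/
theorem IsC4.fourierCoeff_iteratedDeriv (hψ : IsC4 ψ) {j : ℕ} (hj : j ≤ 4) (k : ℤ) :
    fourierCoeff (periodicLift _ (hψ.continuous_iteratedDeriv hj)
      (IsC4.periodic_iteratedDeriv ψ j)) k = (Complex.I * k) ^ j * circleCoeff ψ k := by
  induction j with
  | zero =>
    rw [fourierCoeff_periodicLift, circleCoeff_eq_integral]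
    simp
  | succ j ih =>
    rw [fourierCoeff_periodicLift_deriv (h := iteratedDeriv j fun t : ℝ => ψ (Circle.exp t))
      (fun t => ?_) (hψ.continuous_iteratedDeriv (by omega)) (IsC4.periodic_iteratedDeriv ψ j),
      ih (by omega)]
    · ring
    · rw [iteratedDeriv_succ]
      exact (ContDiff.differentiable_iteratedDeriv j hψ
        (by exact_mod_cast (show j < 4 by omega)) t).hasDerivAt

/-- The weighted coefficients are summable: they are the quotients by `k` of the square-summable
coefficients of the fourth derivative. -/
theorem IsC4.summable_coeff (hψ : IsC4 ψ) :
    Summable fun k : ℤ => ‖circleCoeff ψ k‖ * (1 + |(k : ℝ)|) ^ 3 := by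
  have h4 := summable_sq_norm_fourierCoeff (periodicLift _ (hψ.continuous_iteratedDeriv le_rfl)
      (IsC4.periodic_iteratedDeriv ψ 4))
  simp only [hψ.fourierCoeff_iteratedDeriv le_rfl, norm_mul, norm_pow, Complex.norm_I, one_mul,
    Complex.norm_intCast] at h4
  have h2 : Summable fun k : ℤ => 1 / (k : ℝ) ^ 2 := Real.summable_one_div_int_pow.mpr one_lt_two
  have h0 : Summable fun k : ℤ => if k = 0 then ‖circleCoeff ψ 0‖ else 0 :=
    (hasSum_ite_eq (0 : ℤ) ‖circleCoeff ψ 0‖).summable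
  refine Summable.of_nonneg_of_le (fun k => by positivity) (fun k => ?_)
    (((h4.add h2).mul_left 4).add h0)
  by_cases hk : k = 0
  · subst hk
    simp
  · have hk1 : 1 ≤ |(k : ℝ)| := by exact_mod_cast Int.one_le_abs hk
    simp only [if_neg hk, add_zero]
    rw [← sq_abs (k : ℝ)]
    set r := |(k : ℝ)|
    set a := ‖circleCoeff ψ k‖
    have ha : 0 ≤ a := norm_nonneg _
    have hr : 0 < r := by linarith
    have e1 : (1 + r) ^ 3 ≤ (2 * r) ^ 3 := by gcongr; linarith
    -- The coefficient `r ^ 4 * a` of the fourth derivative and `1 / r` are both square summable.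
    have e2 := sq_nonneg (r ^ 4 * a - 1 / r)
    have e3 : r ^ 4 * a * (1 / r) = r ^ 3 * a := by field_simp
    have e4 : (1 / r) ^ 2 = 1 / r ^ 2 := by rw [div_pow, one_pow]
    have e5 := mul_le_mul_of_nonneg_left e1 ha
    nlinarith

theorem IsC4.summable_coeff_mul (hψ : IsC4 ψ) {u : ℤ → ℂ} {C : ℝ}
    (hu : ∀ k, ‖u k‖ ≤ C * (1 + |(k : ℝ)|) ^ 3) : Summable fun k => circleCoeff ψ k * u k :=
  Summable.of_norm_bounded (hψ.summable_coeff.mul_left C) fun k => by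
    rw [norm_mul]
    have := mul_le_mul_of_nonneg_left (hu k) (norm_nonneg (circleCoeff ψ k))
    linarith

theorem IsC4.hasSum_iteratedDeriv (hψ : IsC4 ψ) {j : ℕ} (hj : j ≤ 3) (t : ℝ) :
    HasSum (fun k : ℤ => circleCoeff ψ k * (Complex.I * k) ^ j * (Circle.exp t : ℂ) ^ k)
      (iteratedDeriv j (fun τ : ℝ => ψ (Circle.exp τ)) t) := by
  have hs : Summable (fourierCoeff (periodicLift _ (hψ.continuous_iteratedDeriv (by omega))
      (IsC4.periodic_iteratedDeriv ψ j))) := by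
    have := hψ.summable_coeff_mul (u := fun k => (Complex.I * k) ^ j) (C := 1) fun k => by
      rw [norm_pow, norm_mul, Complex.norm_I, one_mul, Complex.norm_intCast, one_mul]
      have h0 := abs_nonneg (k : ℝ)
      calc |(k : ℝ)| ^ j ≤ (1 + |(k : ℝ)|) ^ j := by gcongr; linarith
        _ ≤ (1 + |(k : ℝ)|) ^ 3 := pow_le_pow_right₀ (by linarith) hj
    refine this.congr fun k => ?_
    rw [hψ.fourierCoeff_iteratedDeriv (by omega), mul_comm]
  have := has_pointwise_sum_fourier_series_of_summable hs (t : AddCircle (2 * π))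
  have e : periodicLift _ (hψ.continuous_iteratedDeriv (by omega))
      (IsC4.periodic_iteratedDeriv ψ j) (t : AddCircle (2 * π)) =
      iteratedDeriv j (fun τ : ℝ => ψ (Circle.exp τ)) t :=
    (IsC4.periodic_iteratedDeriv ψ j).lift_coe t
  rw [e] at this
  convert this using 1
  ext k
  rw [hψ.fourierCoeff_iteratedDeriv (by omega), fourier_coe_apply, smul_eq_mul, Circle.coe_exp,
    ← Complex.exp_int_mul]
  have hpi : (π : ℂ) ≠ 0 := by exact_mod_cast Real.pi_ne_zero
  rw [mul_comm (circleCoeff ψ k)]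
  congr 2
  push_cast
  field_simp

/-- On functions of class `C⁴` the multiplier is a differential operator. -/
theorem IsC4.multiplierA₁_eq (hψ : IsC4 ψ) (t : ℝ) :
    multiplierA₁ ψ (Circle.exp t) =
      -(1 / 2) * (iteratedDeriv 3 (fun τ : ℝ => ψ (Circle.exp τ)) t +
        deriv (fun τ : ℝ => ψ (Circle.exp τ)) t) := by
  have h := ((hψ.hasSum_iteratedDeriv (j := 3) (by omega) t).add
    (hψ.hasSum_iteratedDeriv (j := 1) (by omega) t)).mul_left (-(1 / 2) : ℂ)
  rw [iteratedDeriv_one] at h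
  rw [← h.tsum_eq]
  unfold multiplierA₁
  congr 1
  ext k
  have : Complex.I ^ 3 = -Complex.I := Complex.I_pow_three
  rw [mul_pow, this]
  ring

end FourierSeries

/-! ### The harmonic entropies on the unit circle -/

/-- Termwise differentiation within a set, at a single point, by dominated convergence of the
difference quotients. -/
theorem hasFDerivWithinAt_tsum {ι E F : Type*} [NormedAddCommGroup E] [NormedSpace ℝ E]
    [NormedAddCommGroup F] [NormedSpace ℝ F] [CompleteSpace F] {S : Set E} {x : E}
    {f : ι → E → F} {f' : ι → E →L[ℝ] F} {u : ι → ℝ} (hu : Summable u)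
    (hd : ∀ k, HasFDerivWithinAt (f k) (f' k) S x)
    (hlip : ∀ k, ∀ y ∈ S, ‖f k y - f k x‖ ≤ u k * ‖y - x‖) (hf' : ∀ k, ‖f' k‖ ≤ u k)
    (hsum : ∀ y ∈ S, Summable fun k => f k y) (hx : x ∈ S) :
    HasFDerivWithinAt (fun y => ∑' k, f k y) (∑' k, f' k) S x := by
  have hs' : Summable f' := Summable.of_norm_bounded hu hf'
  have hq : ∀ y ∈ S, ∀ k, ‖y - x‖⁻¹ * ‖f k y - f k x - f' k (y - x)‖ ≤ 2 * u k := by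
    intro y hy k
    by_cases hyx : y = x
    · subst hyx
      have := (norm_nonneg _).trans (hf' k)
      simpa using this
    · have hpos : 0 < ‖y - x‖ := norm_pos_iff.mpr (sub_ne_zero.mpr hyx)
      rw [inv_mul_le_iff₀ hpos]
      have h1 := hlip k y hy
      have h2 : ‖f' k (y - x)‖ ≤ u k * ‖y - x‖ :=
        (ContinuousLinearMap.le_opNorm _ _).trans (by gcongr; exact hf' k)
      have h3 := norm_sub_le (f k y - f k x) (f' k (y - x))
      linarith
  rw [hasFDerivWithinAt_iff_tendsto]
  have htan : Tendsto (fun y => ∑' k, ‖y - x‖⁻¹ * ‖f k y - f k x - f' k (y - x)‖) (𝓝[S] x)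
      (𝓝 (∑' _ : ι, (0 : ℝ))) := by
    refine tendsto_tsum_of_dominated_convergence (hu.mul_left 2)
      (fun k => hasFDerivWithinAt_iff_tendsto.mp (hd k)) ?_
    filter_upwards [self_mem_nhdsWithin] with y hy k
    rw [Real.norm_of_nonneg (by positivity)]
    exact hq y hy k
  rw [tsum_zero] at htan
  refine squeeze_zero' (Eventually.of_forall fun y => by positivity) ?_ htan
  filter_upwards [self_mem_nhdsWithin] with y hy
  have hsn : Summable fun k => ‖y - x‖⁻¹ * ‖f k y - f k x - f' k (y - x)‖ :=
    Summable.of_nonneg_of_le (fun k => by positivity) (hq y hy) (hu.mul_left 2)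
  by_cases hyx : y = x
  · subst hyx
    simp
  have hpos : ‖y - x‖⁻¹ ≠ 0 := inv_ne_zero (norm_ne_zero_iff.mpr (sub_ne_zero.mpr hyx))
  have e : (∑' k, f k y) - (∑' k, f k x) - (∑' k, f' k) (y - x) =
      ∑' k, (f k y - f k x - f' k (y - x)) := by
    have e1 : (∑' k, f' k) (y - x) = ∑' k, f' k (y - x) :=
      (ContinuousLinearMap.apply ℝ F (y - x)).map_tsum hs'
    have hs'' : Summable fun k => f' k (y - x) :=
      hs'.map (ContinuousLinearMap.apply ℝ F (y - x)) (ContinuousLinearMap.continuous _)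
    rw [e1, ← (hsum y hy).tsum_sub (hsum x hx),
      ← ((hsum y hy).sub (hsum x hx)).tsum_sub hs'']
  rw [e, tsum_mul_left]
  gcongr
  exact norm_tsum_le_tsum_norm ((summable_mul_left_iff hpos).mp hsn)

theorem norm_pow_sub_pow_le {y z : ℂ} (hy : ‖y‖ ≤ 1) (hz : ‖z‖ ≤ 1) (n : ℕ) :
    ‖y ^ n - z ^ n‖ ≤ n * ‖y - z‖ := by
  induction n with
  | zero => simp
  | succ n ih =>
    have e : y ^ (n + 1) - z ^ (n + 1) = y * (y ^ n - z ^ n) + (y - z) * z ^ n := by ring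
    rw [e]
    refine (norm_add_le _ _).trans ?_
    rw [norm_mul, norm_mul, norm_pow]
    have h1 : ‖y‖ * ‖y ^ n - z ^ n‖ ≤ 1 * (n * ‖y - z‖) := by gcongr
    have h2 : ‖y - z‖ * ‖z‖ ^ n ≤ ‖y - z‖ * 1 := by
      gcongr
      exact pow_le_one₀ (norm_nonneg _) hz
    push_cast
    linarith

theorem discMode_natCast (n : ℕ) (z : ℂ) : discMode n z = z ^ n := by
  simp [discMode]

theorem discMode_neg (k : ℤ) (z : ℂ) : discMode (-k) z = conj (discMode k z) := by
  unfold discMode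
  rcases lt_trichotomy k 0 with h | h | h
  · simp [h.le, not_le.mpr h]
  · simp [h]
  · simp [h.le, not_le.mpr h]

theorem norm_discMode_sub_le {y z : ℂ} (hy : ‖y‖ ≤ 1) (hz : ‖z‖ ≤ 1) (k : ℤ) :
    ‖discMode k y - discMode k z‖ ≤ |(k : ℝ)| * ‖y - z‖ := by
  obtain ⟨n, rfl | rfl⟩ := k.eq_nat_or_neg
  · simpa [discMode_natCast] using norm_pow_sub_pow_le hy hz n
  · rw [discMode_neg, discMode_neg, ← map_sub, RCLike.norm_conj]
    simpa [discMode_natCast] using norm_pow_sub_pow_le hy hz n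

theorem norm_discMode_le {z : ℂ} (hz : ‖z‖ ≤ 1) (k : ℤ) : ‖discMode k z‖ ≤ 1 := by
  unfold discMode
  split_ifs <;> simpa using pow_le_one₀ (norm_nonneg z) hz

theorem exists_hasFDerivAt_discMode {z : ℂ} (hz : ‖z‖ ≤ 1) (k : ℤ) :
    ∃ D : ℂ →L[ℝ] ℂ, HasFDerivAt (discMode k) D z ∧ ‖D‖ ≤ |(k : ℝ)| ∧
      D (Complex.I * z) = Complex.I * k * discMode k z := by
  have hnat : ∀ n : ℕ, ∃ D : ℂ →L[ℝ] ℂ, HasFDerivAt (discMode n) D z ∧ ‖D‖ ≤ n ∧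
      D (Complex.I * z) = Complex.I * n * discMode n z := by
    intro n
    have hd : HasFDerivAt (fun z : ℂ => z ^ n)
        ((ContinuousLinearMap.toSpanSingleton ℂ ((n : ℂ) * z ^ (n - 1))).restrictScalars ℝ) z :=
      (hasDerivAt_pow n z).hasFDerivAt.restrictScalars ℝ
    rw [← funext (discMode_natCast n)] at hd
    refine ⟨_, hd, ?_, ?_⟩
    · refine ContinuousLinearMap.opNorm_le_bound _ (Nat.cast_nonneg n) fun v => ?_
      simp only [ContinuousLinearMap.coe_restrictScalars',
        ContinuousLinearMap.toSpanSingleton_apply, smul_eq_mul, norm_mul, norm_pow,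
        Complex.norm_natCast]
      have := pow_le_one₀ (n := n - 1) (norm_nonneg z) hz
      have h2 : (n : ℝ) * ‖z‖ ^ (n - 1) ≤ n := mul_le_of_le_one_right (Nat.cast_nonneg n) this
      have := mul_le_mul_of_nonneg_left h2 (norm_nonneg v)
      linarith
    · rw [discMode_natCast]
      rcases n with _ | n
      · simp
      · simp only [ContinuousLinearMap.coe_restrictScalars',
          ContinuousLinearMap.toSpanSingleton_apply, smul_eq_mul, Nat.add_sub_cancel]
        ring
  obtain ⟨n, rfl | rfl⟩ := k.eq_nat_or_neg
  · simpa using hnat n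
  · obtain ⟨D, h1, h2, h3⟩ := hnat n
    refine ⟨(Complex.conjCLE : ℂ →L[ℝ] ℂ).comp D, ?_, ?_, ?_⟩
    · have : discMode (-(n : ℤ)) = fun z => conj (discMode n z) := funext (discMode_neg _)
      rw [this]
      exact (Complex.conjCLE : ℂ →L[ℝ] ℂ).hasFDerivAt.comp z h1
    · refine ContinuousLinearMap.opNorm_le_bound _ (abs_nonneg _) fun v => ?_
      have := D.le_of_opNorm_le h2 v
      simpa using this
    · rw [discMode_neg, ContinuousLinearMap.comp_apply, h3]
      simp

theorem discMode_of_norm_eq_one {z : ℂ} (hz : ‖z‖ = 1) (k : ℤ) : discMode k z = z ^ k := by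
  obtain ⟨n, rfl | rfl⟩ := k.eq_nat_or_neg
  · rw [discMode_natCast, zpow_natCast]
  · rw [discMode_neg, discMode_natCast, zpow_neg, zpow_natCast, map_pow,
      ← Complex.inv_eq_conj hz, inv_pow]

/-- The harmonic entropy of `Re (c z ^ k)`, `k ∈ ℤ`, on the unit circle. -/
def circleEntropy (k : ℤ) (c z : ℂ) : ℂ :=
  ((c * z ^ k).re : ℂ) * z + ((c * (Complex.I * k) * z ^ k).re : ℂ) * (Complex.I * z)

/-- On the unit circle, the entropy generated by the harmonic extension of `ψ` is the sum of the
entropies of its Fourier modes. -/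
theorem hasSum_circleEntropy {ψ : Circle → ℝ} (hψ : IsC4 ψ) {z : ℂ} (hz : ‖z‖ = 1) :
    HasSum (fun k => circleEntropy k (circleCoeff (fun w => (ψ w : ℂ)) k) z)
      (entropyOf (harmonicExtReal ψ) z) := by
  have hψ' : IsC4 fun w => (ψ w : ℂ) := Complex.ofRealCLM.contDiff.comp hψ
  set c := circleCoeff fun w => (ψ w : ℂ) with hc
  have hone : ∀ k : ℤ, (1 : ℝ) ≤ 1 * (1 + |(k : ℝ)|) ^ 3 := fun k => by
    rw [one_mul]
    exact one_le_pow₀ (by linarith [abs_nonneg (k : ℝ)])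
  have hid : ∀ k : ℤ, |(k : ℝ)| ≤ 1 * (1 + |(k : ℝ)|) ^ 3 := fun k => by
    rw [one_mul]
    have := abs_nonneg (k : ℝ)
    exact le_trans (by linarith) (le_self_pow₀ (by linarith) three_ne_zero)
  choose D hD1 hD2 hD3 using fun k => exists_hasFDerivAt_discMode hz.le k
  have hsum : ∀ y ∈ Metric.closedBall (0 : ℂ) 1, Summable fun k => c k * discMode k y :=
    fun y hy => hψ'.summable_coeff_mul fun k =>
      (norm_discMode_le (mem_closedBall_zero_iff.mp hy) k).trans (hone k)
  have hzb : z ∈ Metric.closedBall (0 : ℂ) 1 := mem_closedBall_zero_iff.mpr hz.le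
  have hu : Summable fun k : ℤ => ‖c k‖ * |(k : ℝ)| := by
    have := (hψ'.summable_coeff_mul (u := fun k => ((|(k : ℝ)| : ℝ) : ℂ)) (C := 1) fun k => by
      simpa using hid k).norm
    simpa using this
  have hder : HasFDerivWithinAt (harmonicExt fun w => (ψ w : ℂ)) (∑' k, c k • D k)
      (Metric.closedBall 0 1) z := by
    refine hasFDerivWithinAt_tsum hu (fun k => ((hD1 k).const_mul (c k)).hasFDerivWithinAt)
      (fun k y hy => ?_) (fun k => ?_) hsum hzb
    · rw [← mul_sub, norm_mul, mul_assoc]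
      gcongr
      exact norm_discMode_sub_le (mem_closedBall_zero_iff.mp hy) hz.le k
    · rw [norm_smul]
      gcongr
      exact hD2 k
  have hder' : HasFDerivWithinAt (harmonicExtReal ψ) (Complex.reCLM.comp (∑' k, c k • D k))
      (Metric.closedBall 0 1) z := Complex.reCLM.hasFDerivAt.comp_hasFDerivWithinAt z hder
  have huniq : UniqueDiffWithinAt ℝ (Metric.closedBall (0 : ℂ) 1) z :=
    uniqueDiffOn_convex (convex_closedBall 0 1)
      ⟨0, by rw [interior_closedBall _ one_ne_zero]; simp⟩ z hzb
  have hsD : Summable fun k => c k • D k := Summable.of_norm_bounded hu fun k => by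
    rw [norm_smul]
    gcongr
    exact hD2 k
  have hs1 : HasSum (fun k => (c k * z ^ k).re) (harmonicExtReal ψ z) := by
    have : HasSum _ (harmonicExtReal ψ z) := Complex.hasSum_re (hsum z hzb).hasSum
    simpa only [discMode_of_norm_eq_one hz] using this
  have hs2 : HasSum (fun k : ℤ => (c k * (Complex.I * k) * z ^ k).re)
      (fderivWithin ℝ (harmonicExtReal ψ) (Metric.closedBall 0 1) z (Complex.I * z)) := by
    rw [hder'.fderivWithin huniq]
    have : HasSum _ (Complex.reCLM.comp (∑' k, c k • D k) (Complex.I * z)) :=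
      Complex.hasSum_re (hsD.hasSum.mapL (ContinuousLinearMap.apply ℝ ℂ (Complex.I * z)))
    simpa only [ContinuousLinearMap.apply_apply, smul_apply, hD3, smul_eq_mul,
      discMode_of_norm_eq_one hz, mul_assoc] using this
  unfold entropyOf circleEntropy
  exact ((Complex.hasSum_ofReal.mpr hs1).mul_right z).add
    ((Complex.hasSum_ofReal.mpr hs2).mul_right (Complex.I * z))

/-! ### Superposition of Fourier modes -/

/-- The identity `div F = g` tested against smooth functions, without integrability. -/
def HasTestDiv (Ω : Set ℂ) (F : ℂ → ℂ) (g : ℂ → ℝ) : Prop :=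
  ∀ ζ : ℂ → ℝ, ContDiff ℝ (⊤ : ℕ∞) ζ → HasCompactSupport ζ → tsupport ζ ⊆ Ω →
    ∫ x in Ω, fderiv ℝ ζ x (F x) = -∫ x in Ω, g x * ζ x

/-- The symbol of the operator `𝒜₁`. -/
def symbolA₁ (k : ℤ) : ℂ := Complex.I * k / 2 * ((k : ℂ) ^ 2 - 1)

section Superposition

variable {Ω : Set ℂ} {M : ℂ → ℂ} {lam : ℂ → ℝ}

theorem HasTestDiv.congr {F F' : ℂ → ℂ} {g g' : ℂ → ℝ} (h : HasTestDiv Ω F g)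
    (hF : ∀ᵐ x ∂(volume.restrict Ω), F x = F' x) (hg : ∀ᵐ x ∂(volume.restrict Ω), g x = g' x) :
    HasTestDiv Ω F' g' := by
  intro ζ h1 h2 h3
  have e1 : ∫ x in Ω, fderiv ℝ ζ x (F' x) = ∫ x in Ω, fderiv ℝ ζ x (F x) :=
    integral_congr_ae (hF.mono fun x hx => by simp only [hx])
  have e2 : ∫ x in Ω, g' x * ζ x = ∫ x in Ω, g x * ζ x :=
    integral_congr_ae (hg.mono fun x hx => by simp only [hx])
  rw [e1, e2, h ζ h1 h2 h3]

theorem circleEntropy_natCast (k : ℕ) (c z : ℂ) : circleEntropy k c z = modeEntropy k c z := by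
  unfold circleEntropy modeEntropy
  rw [zpow_natCast, ← map_pow]
  have e1 : c * z ^ (k + 1) = c * z ^ k * z := by ring
  have e2 : conj c * (z * conj (z ^ k)) = conj (c * z ^ k) * z := by rw [map_mul]; ring
  have e3 : c * (Complex.I * ((k : ℤ) : ℂ)) * z ^ k = (k : ℝ) * (Complex.I * (c * z ^ k)) := by
    push_cast
    ring
  rw [e1, e2, e3]
  generalize c * z ^ k = u
  apply Complex.ext <;> simp <;> ring

theorem re_mul_zpow_neg {z : ℂ} (hz : ‖z‖ = 1) (k : ℤ) (c : ℂ) :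
    (c * z ^ (-k)).re = (conj c * z ^ k).re := by
  rw [← Complex.conj_re (c * z ^ (-k)), map_mul, map_zpow₀, ← Complex.inv_eq_conj hz, zpow_neg,
    inv_zpow, inv_inv]

theorem circleEntropy_neg {z : ℂ} (hz : ‖z‖ = 1) (k : ℤ) (c : ℂ) :
    circleEntropy (-k) c z = circleEntropy k (conj c) z := by
  unfold circleEntropy
  rw [re_mul_zpow_neg hz, re_mul_zpow_neg hz]
  simp

theorem re_symbolA₁_neg {z : ℂ} (hz : ‖z‖ = 1) (k : ℤ) (c : ℂ) :
    (c * symbolA₁ (-k) * z ^ (-k)).re = (conj c * symbolA₁ k * z ^ k).re := by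
  have h2 : conj (2 : ℂ) = 2 := map_ofNat _ 2
  have : conj (symbolA₁ (-k)) = symbolA₁ k := by simp [symbolA₁, h2]
  rw [re_mul_zpow_neg hz, map_mul, this]

theorem norm_symbolA₁_le (k : ℤ) : ‖symbolA₁ k‖ ≤ (1 + |(k : ℝ)|) ^ 3 := by
  unfold symbolA₁
  rw [norm_mul, norm_div, norm_mul, Complex.norm_I, one_mul, Complex.norm_intCast,
    Complex.norm_ofNat]
  have h0 := abs_nonneg (k : ℝ)
  have h : ‖(k : ℂ) ^ 2 - 1‖ ≤ |(k : ℝ)| ^ 2 + 1 := by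
    refine (norm_sub_le _ _).trans ?_
    rw [norm_pow, Complex.norm_intCast, norm_one]
  calc |(k : ℝ)| / 2 * ‖(k : ℂ) ^ 2 - 1‖ ≤ |(k : ℝ)| / 2 * (|(k : ℝ)| ^ 2 + 1) := by gcongr
    _ ≤ _ := by nlinarith [pow_nonneg h0 2, pow_nonneg h0 3]

theorem norm_circleEntropy_le {z : ℂ} (hz : ‖z‖ = 1) (k : ℤ) (c : ℂ) :
    ‖circleEntropy k c z‖ ≤ ‖c‖ * (1 + |(k : ℝ)|) := by
  unfold circleEntropy
  refine (norm_add_le _ _).trans ?_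
  rw [norm_mul, norm_mul, norm_mul, hz, Complex.norm_I, Complex.norm_real, Complex.norm_real,
    Real.norm_eq_abs, Real.norm_eq_abs]
  have h1 := Complex.abs_re_le_norm (c * z ^ k)
  have h2 := Complex.abs_re_le_norm (c * (Complex.I * k) * z ^ k)
  simp only [norm_mul, norm_zpow, hz, one_zpow, Complex.norm_I, Complex.norm_intCast] at h1 h2
  linarith

/-- The divergence of the entropy of every Fourier mode, once it is known for the modes `k ≥ 2`:
mode `0` is a multiple of the field, mode `1` is constant on the unit circle, and conjugation
exchanges the modes `k` and `-k`. -/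
theorem hasTestDiv_circleEntropy (hM : ∀ᵐ x ∂(volume.restrict Ω), ‖M x‖ = 1)
    (hdiv : HasTestDiv Ω M fun _ => 0)
    (hmode : ∀ (n : ℕ) (c : ℂ), HasTestDiv Ω (fun x => modeEntropy (n + 2) c (M x)) fun x =>
      (n + 1) * (n + 2) * (n + 3) / 2 * (Complex.I * c * M x ^ (n + 2)).re * lam x)
    (k : ℤ) (c : ℂ) :
    HasTestDiv Ω (fun x => circleEntropy k c (M x))
      fun x => (c * symbolA₁ k * M x ^ k).re * lam x := by
  have hnat : ∀ (n : ℕ) (c : ℂ), HasTestDiv Ω (fun x => circleEntropy n c (M x))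
      fun x => (c * symbolA₁ n * M x ^ (n : ℤ)).re * lam x := by
    intro n c
    rcases n with _ | _ | n
    · intro ζ h1 h2 h3
      have e : ∀ z, circleEntropy (0 : ℕ) c z = c.re • z := fun z => by simp [circleEntropy]
      have h := hdiv ζ h1 h2 h3
      simp only [e, map_smul, smul_eq_mul]
      rw [integral_const_mul, h]
      simp [symbolA₁]
    · intro ζ h1 h2 h3
      have e : ∀ᵐ x ∂(volume.restrict Ω),
          fderiv ℝ ζ x (circleEntropy (0 + 1 : ℕ) c (M x)) = fderiv ℝ ζ x (conj c) := by
        filter_upwards [hM] with x hx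
        have hx' : M x * conj (M x) = 1 := by
          rw [Complex.mul_conj, Complex.normSq_eq_norm_sq, hx]
          simp
        rw [circleEntropy_natCast]
        simp only [modeEntropy, zero_add, Nat.cast_one, sub_self, zero_mul, pow_one, hx', mul_one]
        congr 1
        ring
      rw [integral_congr_ae e, setIntegral_eq_integral_of_forall_compl_eq_zero,
        integral_fderiv_apply_eq_zero (h1.of_le (by simp)) h2]
      · simp [symbolA₁]
      · intro x hx
        rw [image_eq_zero_of_notMem_tsupport fun h => hx (h3 (tsupport_fderiv_subset ℝ h))]
        simp
    · refine (hmode n c).congr (Eventually.of_forall fun x => ?_)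
        (Eventually.of_forall fun x => ?_)
      · exact (circleEntropy_natCast (n + 2) c (M x)).symm
      · have e : c * symbolA₁ ((n + 1 + 1 : ℕ) : ℤ) * M x ^ ((n + 1 + 1 : ℕ) : ℤ) =
            (((n + 1) * (n + 2) * (n + 3) / 2 : ℝ) : ℂ) * (Complex.I * c * M x ^ (n + 2)) := by
          rw [zpow_natCast]
          unfold symbolA₁
          push_cast
          ring
        rw [e, Complex.re_ofReal_mul]
  obtain ⟨n, rfl | rfl⟩ := k.eq_nat_or_neg
  · exact hnat n c
  · refine (hnat n (conj c)).congr ?_ ?_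
    · filter_upwards [hM] with x hx
      rw [circleEntropy_neg hx]
    · filter_upwards [hM] with x hx
      rw [re_symbolA₁_neg hx]

theorem measurable_zpow (hMm : Measurable M) (k : ℤ) : Measurable fun x => M x ^ k := by
  obtain ⟨n, rfl | rfl⟩ := k.eq_nat_or_neg
  · simpa only [zpow_natCast] using hMm.pow_const n
  · simp only [zpow_neg, zpow_natCast]
    exact (hMm.pow_const n).inv

theorem measurable_circleEntropy (hMm : Measurable M) (k : ℤ) (c : ℂ) :
    Measurable fun x => circleEntropy k c (M x) :=
  ((Complex.measurable_ofReal.comp (Complex.measurable_re.comp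
    ((measurable_zpow hMm k).const_mul _))).mul hMm).add
    ((Complex.measurable_ofReal.comp (Complex.measurable_re.comp
      ((measurable_zpow hMm k).const_mul _))).mul (hMm.const_mul Complex.I))

theorem norm_circleEntropy_le_weight {z : ℂ} (hz : ‖z‖ = 1) (k : ℤ) (c : ℂ) :
    ‖circleEntropy k c z‖ ≤ ‖c‖ * (1 + |(k : ℝ)|) ^ 3 := by
  refine (norm_circleEntropy_le hz k c).trans ?_
  gcongr
  exact le_self_pow₀ (by linarith [abs_nonneg (k : ℝ)]) three_ne_zero

theorem abs_re_symbolA₁_le_weight {z : ℂ} (hz : ‖z‖ = 1) (k : ℤ) (c : ℂ) :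
    ‖(c * symbolA₁ k * z ^ k).re‖ ≤ ‖c‖ * (1 + |(k : ℝ)|) ^ 3 := by
  refine (Complex.abs_re_le_norm _).trans ?_
  rw [norm_mul, norm_mul, norm_zpow, hz, one_zpow, mul_one]
  gcongr
  exact norm_symbolA₁_le k

theorem hasTestDiv_tsum_circleEntropy (hMm : Measurable M)
    (hM : ∀ᵐ x ∂(volume.restrict Ω), ‖M x‖ = 1)
    (hlam : ∀ K, IsCompact K → K ⊆ Ω → IntegrableOn lam K)
    (hmode : ∀ (k : ℤ) (c : ℂ), HasTestDiv Ω (fun x => circleEntropy k c (M x))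
      fun x => (c * symbolA₁ k * M x ^ k).re * lam x)
    {c : ℤ → ℂ} (hc : Summable fun k => ‖c k‖ * (1 + |(k : ℝ)|) ^ 3) :
    HasTestDiv Ω (fun x => ∑' k, circleEntropy k (c k) (M x))
      fun x => (∑' k, (c k * symbolA₁ k * M x ^ k).re) * lam x := by
  intro ζ h1 h2 h3
  have hbE := hM.mono fun x hx k => norm_circleEntropy_le_weight hx k (c k)
  have hbA := hM.mono fun x hx k => abs_re_symbolA₁_le_weight hx k (c k)
  have hζd := h1.continuous_fderiv (by simp)
  have hdi : Integrable (fun x => ‖fderiv ℝ ζ x‖) (volume.restrict Ω) :=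
    (hζd.norm.integrable_of_hasCompactSupport (h2.fderiv ℝ).norm).integrableOn
  have hlζ : Integrable (fun x => lam x * ζ x) (volume.restrict Ω) := by
    have hK : IntegrableOn (fun x => lam x * ζ x) (tsupport ζ) :=
      (hlam _ h2 h3).mul_continuousOn h1.continuous.continuousOn h2
    exact ((integrableOn_iff_integrable_of_support_subset fun x (hx : lam x * ζ x ≠ 0) =>
      subset_tsupport _ (right_ne_zero_of_mul hx)).mp hK).integrableOn
  -- Both sides may be integrated termwise.
  have L : HasSum (fun k => ∫ x in Ω, fderiv ℝ ζ x (circleEntropy k (c k) (M x)))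
      (∫ x in Ω, fderiv ℝ ζ x (∑' k, circleEntropy k (c k) (M x))) := by
    refine hasSum_integral_of_dominated_convergence
      (fun k x => ‖fderiv ℝ ζ x‖ * (‖c k‖ * (1 + |(k : ℝ)|) ^ 3))
      (fun k => ?_) (fun k => ?_) (Eventually.of_forall fun x => hc.mul_left _) ?_ ?_
    · exact isBoundedBilinearMap_apply.continuous.comp_aestronglyMeasurable
        (hζd.aestronglyMeasurable.prodMk (measurable_circleEntropy hMm k _).aestronglyMeasurable)
    · filter_upwards [hbE] with x hx
      exact (ContinuousLinearMap.le_opNorm _ _).trans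
        (mul_le_mul_of_nonneg_left (hx k) (norm_nonneg _))
    · simp only [tsum_mul_left]
      exact hdi.mul_const _
    · filter_upwards [hbE] with x hx
      exact (Summable.of_norm_bounded hc hx).hasSum.mapL (fderiv ℝ ζ x)
  have R : HasSum (fun k => ∫ x in Ω, (c k * symbolA₁ k * M x ^ k).re * lam x * ζ x)
      (∫ x in Ω, (∑' k, (c k * symbolA₁ k * M x ^ k).re) * lam x * ζ x) := by
    refine hasSum_integral_of_dominated_convergence
      (fun k x => |lam x * ζ x| * (‖c k‖ * (1 + |(k : ℝ)|) ^ 3))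
      (fun k => ?_) (fun k => ?_) (Eventually.of_forall fun x => hc.mul_left _) ?_ ?_
    · simp only [mul_assoc _ (lam _)]
      exact (Complex.measurable_re.comp ((measurable_zpow hMm k).const_mul _)).aestronglyMeasurable.mul
        hlζ.aestronglyMeasurable
    · filter_upwards [hbA] with x hx
      rw [mul_assoc, norm_mul, mul_comm, Real.norm_eq_abs (lam x * ζ x)]
      gcongr
      exact hx k
    · simp only [tsum_mul_left]
      exact hlζ.abs.mul_const _
    · filter_upwards [hbA] with x hx
      exact ((Summable.of_norm_bounded hc hx).hasSum.mul_right _).mul_right _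
  have hLR := fun k => hmode k (c k) ζ h1 h2 h3
  simp only [hLR] at L
  exact L.unique R.neg

/-! ### Integrability of the divergences -/

theorem locallyIntegrableOn_of_ae_bound {E : Type*} [NormedAddCommGroup E] (hΩ : IsOpen Ω)
    {F : ℂ → E} {B : ℝ}
    (hm : AEStronglyMeasurable F (volume.restrict Ω))
    (hB : ∀ᵐ x ∂(volume.restrict Ω), ‖F x‖ ≤ B) : LocallyIntegrableOn F Ω := by
  rw [locallyIntegrableOn_iff hΩ.isLocallyClosed]
  intro K hKΩ hK
  have : IsFiniteMeasure (volume.restrict K) := isFiniteMeasure_restrict.mpr hK.measure_lt_top.ne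
  exact Integrable.of_bound (hm.mono_measure (Measure.restrict_mono hKΩ le_rfl)) B
    (ae_restrict_of_ae_restrict_of_subset hKΩ hB)

theorem hasLpLocDiv_of_hasTestDiv (hΩ : IsOpen Ω) {p : ℝ≥0∞} (hp1 : 1 ≤ p)
    (hlam : MemLpLoc Ω p lam) {F : ℂ → ℂ} {a : ℂ → ℝ} {B B' : ℝ}
    (hFm : AEStronglyMeasurable F (volume.restrict Ω))
    (hFB : ∀ᵐ x ∂(volume.restrict Ω), ‖F x‖ ≤ B)
    (ham : AEStronglyMeasurable a (volume.restrict Ω))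
    (haB : ∀ᵐ x ∂(volume.restrict Ω), |a x| ≤ B')
    (h : HasTestDiv Ω F fun x => a x * lam x) : HasLpLocDiv Ω p F fun x => a x * lam x := by
  have hg : MemLpLoc Ω p fun x => a x * lam x := by
    intro K hK hKΩ
    refine (hlam K hK hKΩ).of_le_mul (c := B')
      ((ham.mono_measure (Measure.restrict_mono hKΩ le_rfl)).mul
        (hlam K hK hKΩ).aestronglyMeasurable) ?_
    filter_upwards [ae_restrict_of_ae_restrict_of_subset hKΩ haB] with x hx
    rw [norm_mul]
    gcongr
    exact hx
  refine ⟨hg, locallyIntegrableOn_of_ae_bound hΩ hFm hFB, ?_, h⟩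
  rw [locallyIntegrableOn_iff hΩ.isLocallyClosed]
  intro K hKΩ hK
  have : IsFiniteMeasure (volume.restrict K) := isFiniteMeasure_restrict.mpr hK.measure_lt_top.ne
  exact (hg K hK hKΩ).integrable hp1

end Superposition

/-! ### The Jin–Kohn entropies and the factorization -/

/-- On the unit circle `Σ₁` is an entropy of mode `2`. -/
theorem jinKohn₁_eq {z : ℂ} (hz : ‖z‖ = 1) :
    jinKohn₁ z = circleEntropy 2 (-Complex.I / 3) z := by
  have h : z.re ^ 2 + z.im ^ 2 = 1 := by
    have := Complex.normSq_eq_norm_sq z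
    rw [hz, Complex.normSq_apply] at this
    linarith
  have e : circleEntropy 2 (-Complex.I / 3) z = modeEntropy 2 (-Complex.I / 3) z :=
    circleEntropy_natCast 2 _ z
  rw [e]
  obtain ⟨x, y⟩ := z
  simp only at h
  have h3 : conj (3 : ℂ) = 3 := map_ofNat _ 3
  apply Complex.ext
  · simp [jinKohn₁, modeEntropy, pow_succ, h3]
    linear_combination (-y) * h
  · simp [jinKohn₁, modeEntropy, pow_succ, h3]
    linear_combination (-x) * h

/-- On the unit circle `Σ₂` is an entropy of mode `2`. -/
theorem jinKohn₂_eq {z : ℂ} (hz : ‖z‖ = 1) :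
    jinKohn₂ z = circleEntropy 2 (-1 / 3) z := by
  have h : z.re ^ 2 + z.im ^ 2 = 1 := by
    have := Complex.normSq_eq_norm_sq z
    rw [hz, Complex.normSq_apply] at this
    linarith
  have e : circleEntropy 2 (-1 / 3) z = modeEntropy 2 (-1 / 3) z :=
    circleEntropy_natCast 2 _ z
  rw [e]
  obtain ⟨x, y⟩ := z
  simp only at h
  have h3 : conj (3 : ℂ) = 3 := map_ofNat _ 3
  apply Complex.ext
  · simp [jinKohn₂, modeEntropy, pow_succ, h3]
    linear_combination x * h
  · simp [jinKohn₂, modeEntropy, pow_succ, h3]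
    linear_combination (-y) * h

theorem multiplierA₁_ofReal_im (ψ : Circle → ℝ) (w : Circle) :
    (multiplierA₁ (fun w => (ψ w : ℂ)) w).im = 0 := by
  rw [← Complex.conj_eq_iff_im]
  unfold multiplierA₁
  rw [Complex.conj_tsum, ← (Equiv.neg ℤ).tsum_eq]
  congr 1
  ext k
  have h2 : conj (2 : ℂ) = 2 := map_ofNat _ 2
  have hw : conj (w : ℂ) = (w : ℂ)⁻¹ := (Complex.inv_eq_conj (Circle.norm_coe w)).symm
  simp [circleCoeff_ofReal_neg, h2, hw]

theorem exists_measurable_representative {Ω : Set ℂ} (hΩ : MeasurableSet Ω) {m : ℂ → ℂ}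
    (hm : AEStronglyMeasurable m (volume.restrict Ω))
    (hm1 : ∀ᵐ x ∂(volume.restrict Ω), ‖m x‖ = 1) :
    ∃ M : ℂ → ℂ, Measurable M ∧ (∀ x, ‖M x‖ ≤ 1) ∧ ∀ᵐ x, x ∈ Ω → M x = m x ∧ ‖M x‖ = 1 := by
  have hN : Measurable (hm.mk m) := hm.stronglyMeasurable_mk.measurable
  classical
  refine ⟨fun x => if ‖hm.mk m x‖ ≤ 1 then hm.mk m x else 0,
    Measurable.ite (measurableSet_le hN.norm measurable_const) hN measurable_const, fun x => ?_, ?_⟩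
  · dsimp only
    split_ifs with h
    · exact h
    · simp
  · rw [← ae_restrict_iff' hΩ]
    filter_upwards [hm.ae_eq_mk, hm1] with x h1 h2
    rw [← h1, if_pos h2.le]
    exact ⟨rfl, h2⟩

theorem hasLpLocDiv_superposition {Ω : Set ℂ} (hΩ : IsOpen Ω) {p : ℝ≥0∞} (hp1 : 1 ≤ p)
    {M : ℂ → ℂ} {lam : ℂ → ℝ} (hM : Measurable M)
    (hMm : ∀ᵐ x ∂(volume.restrict Ω), ‖M x‖ = 1) (hlam : MemLpLoc Ω p lam)
    (hmode : ∀ (k : ℤ) (c : ℂ), HasTestDiv Ω (fun x => circleEntropy k c (M x))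
      fun x => (c * symbolA₁ k * M x ^ k).re * lam x)
    {c : ℤ → ℂ} (hc : Summable fun k => ‖c k‖ * (1 + |(k : ℝ)|) ^ 3) {F : ℂ → ℂ}
    (hF : ∀ᵐ x ∂(volume.restrict Ω), HasSum (fun k => circleEntropy k (c k) (M x)) (F x)) :
    HasLpLocDiv Ω p F fun x => (∑' k, (c k * symbolA₁ k * M x ^ k).re) * lam x := by
  have hlami : ∀ K, IsCompact K → K ⊆ Ω → IntegrableOn lam K := fun K hK hKΩ => by
    have : IsFiniteMeasure (volume.restrict K) := isFiniteMeasure_restrict.mpr hK.measure_lt_top.ne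
    exact (hlam K hK hKΩ).integrable hp1
  refine hasLpLocDiv_of_hasTestDiv hΩ hp1 hlam (B := ∑' k, ‖c k‖ * (1 + |(k : ℝ)|) ^ 3)
    (B' := ∑' k, ‖c k‖ * (1 + |(k : ℝ)|) ^ 3) ?_ ?_ ?_ ?_ ?_
  · refine aestronglyMeasurable_of_tendsto_ae atTop
      (f := fun (s : Finset ℤ) x => ∑ k ∈ s, circleEntropy k (c k) (M x)) (fun s => ?_) hF
    exact (Finset.measurable_fun_sum s fun k _ =>
      measurable_circleEntropy hM k (c k)).aestronglyMeasurable
  · filter_upwards [hF, hMm] with x h1 h2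
    rw [← h1.tsum_eq]
    exact tsum_of_norm_bounded hc.hasSum fun k => norm_circleEntropy_le_weight h2 k (c k)
  · refine aestronglyMeasurable_of_tendsto_ae atTop
      (f := fun (s : Finset ℤ) x => ∑ k ∈ s, (c k * symbolA₁ k * M x ^ k).re) (fun s => ?_) ?_
    · exact (Finset.measurable_fun_sum s fun k _ => Complex.measurable_re.comp
        ((measurable_zpow hM k).const_mul _)).aestronglyMeasurable
    · filter_upwards [hMm] with x hx
      exact (Summable.of_norm_bounded hc fun k => abs_re_symbolA₁_le_weight hx k (c k)).hasSum
  · filter_upwards [hMm] with x hx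
    exact tsum_of_norm_bounded hc.hasSum fun k => abs_re_symbolA₁_le_weight hx k (c k)
  · exact (hasTestDiv_tsum_circleEntropy hM hMm hlami hmode hc).congr
      (hF.mono fun x hx => hx.tsum_eq) (Eventually.of_forall fun _ => rfl)

end Eikonal

end

theorem mainTheorem3 (Ω : Set ℂ) (hΩ : IsOpen Ω) (m : ℂ → ℂ)
    (hm : Eikonal.IsEikonalSolution Ω m)
    (p : ℝ≥0∞) (hp1 : 1 ≤ p) (hp : p ≠ ∞)
    (ε : ℕ → ℝ) (hε : ∀ k, 0 < ε k) (hε0 : Tendsto ε atTop (𝓝 0))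
    (P : ℂ → ℝ)
    (hP : Eikonal.TendstoWeaklyLpLoc Ω p (fun k => Eikonal.cubicIncrement m (ε k)) P)
    (θ : ℂ → ℝ) (hθ : ∀ x ∈ Ω, θ x ∈ Ico 0 (2 * π))
    (hmθ : ∀ᵐ x ∂(volume.restrict Ω), m x = Complex.exp (θ x * Complex.I)) :
    (∃ s₁ s₂ : ℂ → ℝ,
      Eikonal.HasLpLocDiv Ω p (fun x => Eikonal.jinKohn₁ (m x)) s₁ ∧
      Eikonal.HasLpLocDiv Ω p (fun x => Eikonal.jinKohn₂ (m x)) s₂ ∧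
      (∀ᵐ x ∂(volume.restrict Ω),
        inner ℝ (Complex.I * Complex.exp (2 * θ x * Complex.I)) (⟨s₁ x, s₂ x⟩ : ℂ) = 0) ∧
      ∀ ψ : Circle → ℝ, Eikonal.IsC4 ψ →
        ∃ g : ℂ → ℝ,
          Eikonal.HasLpLocDiv Ω p
            (fun x => Eikonal.entropyOf (Eikonal.harmonicExtReal ψ) (m x)) g ∧
          ∀ᵐ x ∂(volume.restrict Ω),
            (g x : ℂ) =
              Eikonal.multiplierA₁ (fun w => (ψ w : ℂ)) (Circle.exp (θ x)) *
                (inner ℝ (Complex.exp (2 * θ x * Complex.I)) (⟨s₁ x, s₂ x⟩ : ℂ) : ℝ)) ∧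
    ∀ ψ : Circle → ℂ, Eikonal.IsC4 ψ → ∀ t : ℝ,
      Eikonal.multiplierA₁ ψ (Circle.exp t) =
        -(1 / 2) * (iteratedDeriv 3 (fun τ : ℝ => ψ (Circle.exp τ)) t +
          deriv (fun τ : ℝ => ψ (Circle.exp τ)) t) := by
  open Eikonal in
  refine ⟨?_, fun ψ hψ t => hψ.multiplierA₁_eq t⟩
  obtain ⟨hm1, hmloc, -, hmdiv⟩ := hm
  have hmm : AEStronglyMeasurable m (volume.restrict Ω) := hmloc.aestronglyMeasurable
  obtain ⟨M, hM, hM1, hMm⟩ := exists_measurable_representative hΩ.measurableSet hmm hm1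
  have hMr : ∀ᵐ x ∂(volume.restrict Ω), M x = m x ∧ ‖M x‖ = 1 :=
    (ae_restrict_iff' hΩ.measurableSet).mpr hMm
  have hMn : ∀ᵐ x ∂(volume.restrict Ω), ‖M x‖ = 1 := hMr.mono fun x hx => hx.2
  have hMdiv : HasTestDiv Ω M fun _ => 0 :=
    HasTestDiv.congr hmdiv (hMr.mono fun x hx => hx.1.symm) (Eventually.of_forall fun _ => rfl)
  obtain ⟨C, lam, hlam⟩ := exists_isDefectCurlLimit hΩ hp1 hM hM1 hMm hε hε0 hP
  have hlamp : MemLpLoc Ω p lam := by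
    intro K hK hKΩ
    obtain ⟨U, hU, hKU, hUΩ, hUc⟩ := exists_open_between_and_isCompact_closure hK hΩ hKΩ
    obtain ⟨h1, h2, -⟩ := hlam U hU hUc hUΩ
    refine MemLp.mono_measure (Measure.restrict_mono hKU le_rfl) ?_
    refine (hP U hU hUc hUΩ).2.1.of_le_mul (c := |C|) h1.aestronglyMeasurable ?_
    filter_upwards [h2] with x hx
    rw [Real.norm_eq_abs, Real.norm_eq_abs, ← abs_mul]
    exact hx.trans (le_abs_self _)
  have hmode := hasTestDiv_circleEntropy hMn hMdiv
    (fun n c ζ h1 h2 h3 => integral_fderiv_modeEntropy_add_two hΩ hp1 hM hM1 hMm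
      (fun ζ h1 h2 h3 => by simpa using hMdiv ζ h1 h2 h3) hε hε0 hP hlam n c h1 h2 h3)
  have hsup := fun (c : ℤ → ℂ) (hc : Summable fun k => ‖c k‖ * (1 + |(k : ℝ)|) ^ 3) (F : ℂ → ℂ) =>
    hasLpLocDiv_superposition hΩ hp1 hM hMn hlamp hmode hc (F := F)
  -- A single mode, as a superposition with one term.
  have hsingle : ∀ (k : ℤ) (c : ℂ) (F : ℂ → ℂ),
      (∀ᵐ x ∂(volume.restrict Ω), F x = circleEntropy k c (M x)) →
      HasLpLocDiv Ω p F fun x => (c * symbolA₁ k * M x ^ k).re * lam x := by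
    intro k c F hF
    have hne : ∀ j, j ≠ k → (Pi.single k c : ℤ → ℂ) j = 0 := fun j hj => by simp [hj]
    have h := hsup (Pi.single k c)
      (summable_of_ne_finset_zero (s := {k}) fun j hj => by
        rw [hne j (by simpa using hj), norm_zero, zero_mul]) F (by
        filter_upwards [hF] with x hx
        rw [hx]
        have := hasSum_single (f := fun j => circleEntropy j ((Pi.single k c : ℤ → ℂ) j) (M x)) k
          fun j hj => by simp [hne j hj, circleEntropy]
        simpa using this)
    have e : ∀ x, (∑' j, ((Pi.single k c : ℤ → ℂ) j * symbolA₁ j * M x ^ j).re) =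
        (c * symbolA₁ k * M x ^ k).re := fun x => by
      rw [tsum_eq_single k fun j hj => by simp [hne j hj]]
      simp
    simpa only [e] using h
  have hM2 : ∀ᵐ x ∂(volume.restrict Ω), Complex.exp (2 * θ x * Complex.I) = M x ^ 2 ∧
      M x = Circle.exp (θ x) ∧ ‖M x‖ = 1 := by
    filter_upwards [hMr, hmθ] with x h1 h2
    refine ⟨?_, ?_, h1.2⟩
    · rw [h1.1, h2, ← Complex.exp_nat_mul]
      congr 1
      push_cast
      ring
    · rw [h1.1, h2, Circle.coe_exp]
  -- The two divergences are the components of `lam • m²`.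
  have hsym : symbolA₁ 2 = 3 * Complex.I := by
    unfold symbolA₁
    push_cast
    ring
  have e₁ : ∀ x, (-Complex.I / 3 * symbolA₁ 2 * M x ^ (2 : ℤ)).re = (M x ^ 2).re := fun x => by
    have : -Complex.I / 3 * symbolA₁ 2 * M x ^ (2 : ℤ) = -(Complex.I ^ 2) * M x ^ 2 := by
      rw [hsym, zpow_ofNat]
      ring
    rw [this, Complex.I_sq, neg_neg, one_mul]
  have e₂ : ∀ x, (-1 / 3 * symbolA₁ 2 * M x ^ (2 : ℤ)).re = (M x ^ 2).im := fun x => by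
    have : -1 / 3 * symbolA₁ 2 * M x ^ (2 : ℤ) = -(Complex.I * M x ^ 2) := by
      rw [hsym, zpow_ofNat]
      ring
    rw [this, Complex.neg_re, Complex.I_mul_re, neg_neg]
  have hS₁ := hsingle 2 (-Complex.I / 3) (fun x => jinKohn₁ (m x)) (by
    filter_upwards [hMr] with x hx
    rw [← hx.1, jinKohn₁_eq hx.2])
  have hS₂ := hsingle 2 (-1 / 3) (fun x => jinKohn₂ (m x)) (by
    filter_upwards [hMr] with x hx
    rw [← hx.1, jinKohn₂_eq hx.2])
  simp only [e₁] at hS₁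
  simp only [e₂] at hS₂
  have hpair : ∀ x, (⟨(M x ^ 2).re * lam x, (M x ^ 2).im * lam x⟩ : ℂ) = lam x • M x ^ 2 :=
    fun x => by apply Complex.ext <;> simp [mul_comm]
  refine ⟨_, _, hS₁, hS₂, ?_, fun ψ hψ => ?_⟩
  · filter_upwards [hM2] with x hx
    rw [hpair, hx.1, real_inner_smul_right]
    generalize M x ^ 2 = z
    simp only [Complex.inner, map_mul, Complex.conj_I]
    rw [mul_left_comm, Complex.mul_conj]
    simp
  · have hψ' : IsC4 fun w => (ψ w : ℂ) := Complex.ofRealCLM.contDiff.comp hψ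
    refine ⟨_, hsup _ hψ'.summable_coeff _ (by
      filter_upwards [hMr] with x hx
      rw [← hx.1]
      exact hasSum_circleEntropy hψ hx.2), ?_⟩
    filter_upwards [hM2] with x hx
    rw [hpair, hx.1, real_inner_smul_right, real_inner_self_eq_norm_sq, norm_pow, hx.2.2]
    have hA : multiplierA₁ (fun w => (ψ w : ℂ)) (Circle.exp (θ x)) =
        ((∑' k, (circleCoeff (fun w => (ψ w : ℂ)) k * symbolA₁ k * M x ^ k).re : ℝ) : ℂ) := by
      have hs : Summable fun k => circleCoeff (fun w => (ψ w : ℂ)) k * symbolA₁ k * M x ^ k := by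
        simp only [mul_assoc]
        refine hψ'.summable_coeff_mul (C := 1) fun k => ?_
        rw [norm_mul, norm_zpow, hx.2.2, one_zpow, mul_one, one_mul]
        exact norm_symbolA₁_le k
      have hre := (Complex.hasSum_re hs.hasSum).tsum_eq
      have hmul : multiplierA₁ (fun w => (ψ w : ℂ)) (Circle.exp (θ x)) =
          ∑' k, circleCoeff (fun w => (ψ w : ℂ)) k * symbolA₁ k * M x ^ k := by
        rw [hx.2.1]
        rfl
      rw [hre, ← hmul]
      exact Complex.ext rfl (by
        rw [multiplierA₁_ofReal_im, Complex.ofReal_im])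
    rw [hA]
    push_cast
    ring
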